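/- Let $k$ be a field and let $B=\bigoplus_{n\ge 0}B_n$ be a standard graded artinian $k$-algebra (so $B_0=k$, $B$ is generated by $B_1$, and $\dim_k B<\infty$) with socle degree $s$, the largest degree with $B_s\neq 0$; put $B_n=0$ for $n<0$. Let $d\geq 1$ and $A=B\otimes_k k[x]/(x^d)$, graded by $A_n=\bigoplus_{m=0}^{d-1}B_{n-m}\,x^m$, and let $i,t\geq 0$ be integers. For $0\le p\le d$ let $C_{t,p,d}$ be the integer matrix of size $(d-p)\times(d-p)$ with entry $\binom{t}{d+1-a-b}$ in row $a$ and column $b$, $1\le a,b\le d-p$, where $\binom{t}{j}=0$ if $j<0$ or $j>t$ (the empty matrix has determinant $1$). Assume that the characteristic of $k$ is $0$ or a prime not dividing $$\prod_{p=\max\{1,\,d-i,\,i+t-s+1\}}^{\min\{d-1,\,t-1\}}\det(C_{t,p,d}). \tag{1}$$ Let $\overline{\ell}\in B_1$ be any linear form (in particular, a general one) and let $\ell=\overline{\ell}+x\in A_1$. A linear map is said to have full rank if its rank is the minimum of the dimensions of its source and target, and a family of linear maps has full rank for the same reason if all its members are injective or all are surjective. (a) Suppose moreover that the characteristic of $k$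 is $0$ or a prime not dividing $$\prod_{p=\max\{1,\,d-1-i,\,i+t-s\}}^{\min\{d-1,\,t-1\}}\det(C_{t,p,d}). \tag{2}$$ Then the map $\cdot\ell^t:A_i\to A_{i+t}$ has full rank if and only if the maps $$\cdot\overline{\ell}^{\,2q+t-(d-1)}:B_{i-q}\to B_{i+q+t-(d-1)},\qquad \max\{0,d-t\}\le q\le d-1, \tag{3}$$ have full rank for the same reason. (b) Under (1) alone, if $\cdot\ell^t:A_i\to A_{i+t}$ has full rank, then the maps (3) have full rank for the same reason. (c) Under (1) alone, choose a basis of each $B_n$, and give each $A_n$ the basis formed by the products of $x^m$ with the basis of $B_{n-m}$ for $0\le m\le d-1$. Let $\overline{M}_{i-q}^{2q+t-(d-1)}$ and $M$ be the matrices of the maps (3) and of $\cdot\ell^t:A_i\to A_{i+t}$ in these bases. If the matrices $\overline{M}_{i-q}^{2q+t-(d-1)}$ for $\max\{0,d-t\}\le q\le\min\{d-1,\,d-1-i-t+s,\,i\}$ and the matrix $M$ are all square, then, as elements of $k$ and up to sign, $$\det(M)=\pm F_1F_2F_3,$$ where $$F_1=\prod_{q=\max\{0,d-t\}}^{\min\{d-1,\,d-1-i-t+s,\,i\}}\det\bigl(\overline{M}_{i-q}^{2q+t-(d-1)}\bigr),$$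 $$F_2=\prod_{p=\max\{1,\,1+i+t-s,\,d-i-1\}}^{\min\{d-1,\,t-1\}}|\det(C_{t,p,d})|^{\dim_k B_{i+p-(d-1)}-\dim_k B_{i+p-d}},$$ and $F_3=|\det(C_{t,i+t-s,d})|^{\dim_k B_{2i-(d-1)+t-s}}$ if $\min\{d-1,t-1\}\ge i+t-s\ge\max\{0,d-1-i\}$, while $F_3=1$ otherwise. -/

import Mathlib

open scoped TensorProduct Polynomial

/-- A standard graded artinian `k`-algebra `B = B₀ ⊕ B₁ ⊕ ⋯`: the degree-zero part is `k`, the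
algebra is generated by `B₁`, and it has finite `k`-dimension.  (Equivalently, `B` is a
finite-dimensional quotient of `k[x₁, …, xₙ]`, with its standard grading, by a proper
homogeneous ideal.) -/
structure IsStandardGradedArtinian {k B : Type*} [Field k] [CommRing B] [Algebra k B]
    (𝓑 : ℕ → Submodule k B) [GradedAlgebra 𝓑] : Prop where
  nontrivial : Nontrivial B
  degree_zero : 𝓑 0 = 1
  generated : Algebra.adjoin k (𝓑 1 : Set B) = ⊤
  finite : Module.Finite k B

/-- `s` is the socle degree: the largest degree whose graded piece is nonzero. -/
def IsSocleDegree {k B : Type*} [Field k] [CommRing B] [Algebra k B]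
    (𝓑 : ℕ → Submodule k B) (s : ℕ) : Prop :=
  IsGreatest {n | 𝓑 n ≠ ⊥} s

/-- The graded piece of integer degree `j`; it is zero when `j < 0`. -/
def gr {k R : Type*} [Field k] [CommRing R] [Algebra k R] (𝓡 : ℕ → Submodule k R) (j : ℤ) :
    Submodule k R :=
  if 0 ≤ j then 𝓡 j.toNat else ⊥

theorem pow_mul_mem_gr {k R : Type*} [Field k] [CommRing R] [Algebra k R]
    (𝓡 : ℕ → Submodule k R) [SetLike.GradedMonoid 𝓡] (ℓ : 𝓡 1) (m : ℕ) (j : ℤ) (v : R)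
    (hv : v ∈ gr 𝓡 j) : LinearMap.mulLeft k ((ℓ : R) ^ m) v ∈ gr 𝓡 (j + m) := by
  unfold gr at hv ⊢
  split_ifs at hv with h
  · rw [if_pos (by omega)]
    have h1 : (ℓ : R) ^ m ∈ 𝓡 (m • 1) := SetLike.pow_mem_graded m ℓ.2
    have h2 := SetLike.mul_mem_graded h1 hv
    have h3 : m • 1 + j.toNat = (j + m).toNat := by simp; omega
    rw [h3] at h2
    simpa using h2
  · rw [(Submodule.mem_bot k).1 hv, map_zero]
    exact Submodule.zero_mem _

/-- Multiplication by `ℓ ^ m`, for a linear form `ℓ`, as a map `R_j → R_{j + m}`. -/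
def powMul {k R : Type*} [Field k] [CommRing R] [Algebra k R]
    (𝓡 : ℕ → Submodule k R) [SetLike.GradedMonoid 𝓡] (ℓ : 𝓡 1) (m : ℕ) (j : ℤ) :
    gr 𝓡 j →ₗ[k] gr 𝓡 (j + m) :=
  (LinearMap.mulLeft k ((ℓ : R) ^ m)).restrict (pow_mul_mem_gr 𝓡 ℓ m j)

/-- A linear map of finite-dimensional spaces has full rank if its rank is the largest possible,
namely the smaller of the two dimensions. -/
def HasFullRank {k V W : Type*} [Field k] [AddCommGroup V] [Module k V] [AddCommGroup W]
    [Module k W] (f : V →ₗ[k] W) : Prop :=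
  Module.finrank k (LinearMap.range f) = min (Module.finrank k V) (Module.finrank k W)

/-- The maps of a family have full rank for the same reason: all of them are injective, or all of
them are surjective. -/
def FullRankForSameReason {k I : Type*} {V W : I → Type*} [Field k]
    [∀ q, AddCommGroup (V q)] [∀ q, Module k (V q)]
    [∀ q, AddCommGroup (W q)] [∀ q, Module k (W q)] (f : ∀ q, V q →ₗ[k] W q) : Prop :=
  (∀ q, Function.Injective (f q)) ∨ (∀ q, Function.Surjective (f q))

/-- The algebra `A = B ⊗ₖ k[x]/(x^d)`. -/
abbrev TruncExt (k B : Type*) [Field k] [CommRing B] [Algebra k B] (d : ℕ) : Type _ :=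
  B ⊗[k] AdjoinRoot (Polynomial.X ^ d : k[X])

/-- The class of `x` in `k[x]/(x^d)`. -/
noncomputable def truncX (k : Type*) [Field k] (d : ℕ) : AdjoinRoot (Polynomial.X ^ d : k[X]) :=
  AdjoinRoot.root _

/-- The grading of `A = B ⊗ₖ k[x]/(x^d)`: the piece of degree `n` is the sum of the
`B_a ⊗ x^m` over `a + m = n`. -/
noncomputable def extGrading {k B : Type*} [Field k] [CommRing B] [Algebra k B]
    (𝓑 : ℕ → Submodule k B) (d : ℕ) (n : ℕ) : Submodule k (TruncExt k B d) :=
  Submodule.span k {z | ∃ a m : ℕ, a + m = n ∧ ∃ b ∈ 𝓑 a, z = b ⊗ₜ[k] (truncX k d ^ m)}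

instance extGrading_gradedMonoid {k B : Type*} [Field k] [CommRing B] [Algebra k B]
    (𝓑 : ℕ → Submodule k B) [GradedAlgebra 𝓑] (d : ℕ) :
    SetLike.GradedMonoid (extGrading 𝓑 d) where
  one_mem := Submodule.subset_span
    ⟨0, 0, rfl, 1, SetLike.one_mem_graded 𝓑, by rw [pow_zero, Algebra.TensorProduct.one_def]⟩
  mul_mem := by
    intro i j u v hu hv
    induction hu using Submodule.span_induction with
    | zero => rw [zero_mul]; exact Submodule.zero_mem _
    | add y z _ _ hy hz => rw [add_mul]; exact Submodule.add_mem _ hy hz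
    | smul c y _ hy => rw [smul_mul_assoc]; exact Submodule.smul_mem _ c hy
    | mem y hy =>
      obtain ⟨a, m, rfl, b, hb, rfl⟩ := hy
      induction hv using Submodule.span_induction with
      | zero => rw [mul_zero]; exact Submodule.zero_mem _
      | add y z _ _ hy hz => rw [mul_add]; exact Submodule.add_mem _ hy hz
      | smul c y _ hy => rw [mul_smul_comm]; exact Submodule.smul_mem _ c hy
      | mem y hy =>
        obtain ⟨a', m', rfl, b', hb', rfl⟩ := hy
        refine Submodule.subset_span ⟨a + a', m + m', by omega, b * b',
          SetLike.mul_mem_graded hb hb', ?_⟩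
        rw [Algebra.TensorProduct.tmul_mul_tmul, pow_add]

/-- The linear form `ℓ = ℓ' + x` of `A = B ⊗ₖ k[x]/(x^d)`, for a linear form `ℓ'` of `B`. -/
noncomputable def extForm {k B : Type*} [Field k] [CommRing B] [Algebra k B]
    (𝓑 : ℕ → Submodule k B) [GradedAlgebra 𝓑] (d : ℕ) (ℓ : 𝓑 1) : extGrading 𝓑 d 1 :=
  ⟨(ℓ : B) ⊗ₜ[k] 1 + 1 ⊗ₜ[k] truncX k d, Submodule.add_mem _
    (Submodule.subset_span ⟨1, 0, rfl, ℓ, ℓ.2, by rw [pow_zero]⟩)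
    (Submodule.subset_span ⟨0, 1, rfl, 1, SetLike.one_mem_graded 𝓑, by rw [pow_one]⟩)⟩

/-- The basis `1, x, …, x^(d-1)` of `k[x]/(x^d)`. -/
noncomputable def truncBasis (k : Type*) [Field k] (d : ℕ) :
    Module.Basis (Fin d) k (AdjoinRoot (Polynomial.X ^ d : k[X])) :=
  (AdjoinRoot.powerBasis' (Polynomial.monic_X_pow d)).basis.reindex
    (finCongr (by simp))

theorem truncBasis_apply (k : Type*) [Field k] (d : ℕ) (m : Fin d) :
    truncBasis k d m = truncX k d ^ (m : ℕ) := by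
  simp [truncBasis, truncX]

theorem truncX_pow_eq_zero (k : Type*) [Field k] (d m : ℕ) (h : d ≤ m) : truncX k d ^ m = 0 := by
  have h0 : truncX k d ^ d = 0 := by
    rw [truncX, ← AdjoinRoot.mk_X, ← map_pow, AdjoinRoot.mk_self]
  exact pow_eq_zero_of_le h h0

/-- The map `(v_m)_m ↦ ∑ v_m ⊗ x^m` from `⨁_{m < d} B_{j-m}` to `A`. -/
noncomputable def extSum {k B : Type*} [Field k] [CommRing B] [Algebra k B]
    (𝓑 : ℕ → Submodule k B) (d : ℕ) (j : ℤ) :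
    (∀ m : Fin d, gr 𝓑 (j - (m : ℕ))) →ₗ[k] TruncExt k B d :=
  ∑ m : Fin d, ((TensorProduct.mk k B _).flip (truncX k d ^ (m : ℕ))) ∘ₗ
    (gr 𝓑 (j - (m : ℕ))).subtype ∘ₗ LinearMap.proj m

theorem extSum_apply {k B : Type*} [Field k] [CommRing B] [Algebra k B]
    (𝓑 : ℕ → Submodule k B) (d : ℕ) (j : ℤ) (v : ∀ m : Fin d, gr 𝓑 (j - (m : ℕ))) :
    extSum 𝓑 d j v = ∑ m : Fin d, (v m : B) ⊗ₜ[k] (truncX k d ^ (m : ℕ)) := by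
  simp [extSum]

theorem extSum_injective {k B : Type*} [Field k] [CommRing B] [Algebra k B]
    (𝓑 : ℕ → Submodule k B) (d : ℕ) (j : ℤ) : Function.Injective (extSum 𝓑 d j) := by
  rw [← LinearMap.ker_eq_bot, LinearMap.ker_eq_bot']
  intro v hv
  rw [extSum_apply] at hv
  funext m
  have h := congrArg (fun z => TensorProduct.equivFinsuppOfBasisRight (truncBasis k d) z m) hv
  simp only [← truncBasis_apply, map_sum, Finsupp.coe_finsetSum, Finset.sum_apply,
    TensorProduct.equivFinsuppOfBasisRight_apply_tmul_apply, Module.Basis.repr_self, map_zero,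
    Finsupp.coe_zero, Pi.zero_apply] at h
  rw [Finset.sum_eq_single m] at h
  · apply Subtype.ext
    simpa using h
  · intro n _ hn
    rw [Finsupp.single_eq_of_ne hn.symm, zero_smul]
  · simp

theorem range_extSum {k B : Type*} [Field k] [CommRing B] [Algebra k B]
    (𝓑 : ℕ → Submodule k B) (d : ℕ) (j : ℤ) :
    LinearMap.range (extSum 𝓑 d j) = gr (extGrading 𝓑 d) j := by
  apply le_antisymm
  · rintro _ ⟨v, rfl⟩
    rw [extSum_apply]
    refine Submodule.sum_mem _ fun m _ => ?_
    have hm := (v m).2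
    generalize (v m : B) = w at hm ⊢
    unfold gr at hm ⊢
    split_ifs at hm with h
    · rw [if_pos (by omega)]
      exact Submodule.subset_span ⟨_, m, by omega, w, hm, rfl⟩
    · rw [(Submodule.mem_bot k).1 hm, TensorProduct.zero_tmul]
      exact Submodule.zero_mem _
  · intro z hz
    by_cases h : 0 ≤ j
    · rw [gr, if_pos h] at hz
      refine Submodule.span_le.2 ?_ hz
      rintro _ ⟨a, m, ham, b, hb, rfl⟩
      by_cases hm : d ≤ m
      · rw [truncX_pow_eq_zero k d m hm, TensorProduct.tmul_zero]
        exact Submodule.zero_mem _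
      · push Not at hm
        have hb' : b ∈ gr 𝓑 (j - ((⟨m, hm⟩ : Fin d) : ℕ)) := by
          have h1 : (j - ((⟨m, hm⟩ : Fin d) : ℕ)).toNat = a := by simp only []; omega
          rw [gr, if_pos (by simp only []; omega), h1]
          exact hb
        refine ⟨Pi.single ⟨m, hm⟩ ⟨b, hb'⟩, ?_⟩
        rw [extSum_apply, Finset.sum_eq_single ⟨m, hm⟩]
        · simp
        · intro n _ hn
          simp [Pi.single_eq_of_ne hn]
        · simp
    · rw [gr, if_neg h, Submodule.mem_bot] at hz
      rw [hz]
      exact Submodule.zero_mem _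

/-- The decomposition `A_j = B_j ⊕ x B_{j-1} ⊕ ⋯ ⊕ x^(d-1) B_{j-(d-1)}`. -/
noncomputable def extEquiv {k B : Type*} [Field k] [CommRing B] [Algebra k B]
    (𝓑 : ℕ → Submodule k B) (d : ℕ) (j : ℤ) :
    (∀ m : Fin d, gr 𝓑 (j - (m : ℕ))) ≃ₗ[k] gr (extGrading 𝓑 d) j :=
  (LinearEquiv.ofInjective (extSum 𝓑 d j) (extSum_injective 𝓑 d j)).trans
    (LinearEquiv.ofEq _ _ (range_extSum 𝓑 d j))

/-- The basis of `A_j` induced by bases of the graded pieces of `B`: it is the disjoint union of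
the `x^m · (basis of B_{j-m})` over `0 ≤ m ≤ d - 1`. -/
noncomputable def extBasis {k B : Type*} [Field k] [CommRing B] [Algebra k B]
    (𝓑 : ℕ → Submodule k B) (d : ℕ) {ι : ℤ → Type*} [∀ n, Fintype (ι n)]
    (b : ∀ n : ℤ, Module.Basis (ι n) k (gr 𝓑 n)) (j : ℤ) :
    Module.Basis (Σ m : Fin d, ι (j - (m : ℕ))) k (gr (extGrading 𝓑 d) j) :=
  (Pi.basis fun m : Fin d => b (j - (m : ℕ))).map (extEquiv 𝓑 d j)

theorem extBasis_apply {k B : Type*} [Field k] [CommRing B] [Algebra k B]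
    (𝓑 : ℕ → Submodule k B) (d : ℕ) {ι : ℤ → Type*} [∀ n, Fintype (ι n)]
    (b : ∀ n : ℤ, Module.Basis (ι n) k (gr 𝓑 n)) (j : ℤ) (m : Fin d) (c : ι (j - (m : ℕ))) :
    (extBasis 𝓑 d b j ⟨m, c⟩ : TruncExt k B d) =
      (b (j - (m : ℕ)) c : B) ⊗ₜ[k] (truncX k d ^ (m : ℕ)) := by
  have h : (extBasis 𝓑 d b j ⟨m, c⟩ : TruncExt k B d) =
      extSum 𝓑 d j (Pi.single m (b (j - (m : ℕ)) c)) := by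
    simp [extBasis, extEquiv]
  rw [h, extSum_apply, Finset.sum_eq_single m]
  · simp
  · intro n _ hn
    simp [Pi.single_eq_of_ne hn]
  · simp

/-- The binomial coefficient `t` over `j` for an integer `j`; it is zero for `j < 0`
(and for `j > t`). -/
def binom (t : ℕ) (j : ℤ) : ℤ :=
  if 0 ≤ j then (t.choose j.toNat : ℤ) else 0

/-- The integer matrix `C_{t,p,d}`, of size `d - p`, whose entry in row `r` and column `c`
(counted from `0`) is `binom t (d - 1 - r - c)`.  It is empty, of determinant `1`, when
`p = d`. -/
def matC (t p d : ℕ) : Matrix (Fin (d - p)) (Fin (d - p)) ℤ :=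
  Matrix.of fun r c => binom t ((d : ℤ) - 1 - (r : ℕ) - (c : ℕ))

/-- The characteristic of `k` is zero or a prime which does not divide
`∏_{p = lo}^{min(d - 1, t - 1)} det C_{t,p,d}`. -/
def CharCond (k : Type*) [Field k] (t d lo : ℕ) : Prop :=
  ringChar k = 0 ∨
    ¬ ((ringChar k : ℤ) ∣ ∏ p ∈ Finset.Icc lo (min (d - 1) (t - 1)), (matC t p d).det)

/-- The exponent `2q + t - (d - 1)`, which is not truncated when `q ≥ d - t`. -/
def qExp (d t q : ℕ) : ℕ := 2 * q + t - (d - 1)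

/-- The map `B_{i-q} → B_{i+q+t-(d-1)}` given by multiplication by `ℓ ^ (2q + t - (d - 1))`; the
target degree is written as `(i - q) + (2q + t - (d - 1))`. -/
def recMap {k B : Type*} [Field k] [CommRing B] [Algebra k B]
    (𝓑 : ℕ → Submodule k B) [GradedAlgebra 𝓑] (ℓ : 𝓑 1) (d t i q : ℕ) :
    gr 𝓑 ((i : ℤ) - (q : ℤ)) →ₗ[k] gr 𝓑 ((i : ℤ) - (q : ℤ) + (qExp d t q : ℤ)) :=
  powMul 𝓑 ℓ (qExp d t q) ((i : ℤ) - (q : ℤ))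

/-- The multiplication map `ℓ^t : A_i → A_{i+t}` for `A = B ⊗ₖ k[x]/(x^d)` and `ℓ = ℓ' + x`. -/
noncomputable def extMap {k B : Type*} [Field k] [CommRing B] [Algebra k B]
    (𝓑 : ℕ → Submodule k B) [GradedAlgebra 𝓑] (ℓ : 𝓑 1) (d t i : ℕ) :
    gr (extGrading 𝓑 d) (i : ℤ) →ₗ[k] gr (extGrading 𝓑 d) ((i : ℤ) + (t : ℤ)) :=
  powMul (extGrading 𝓑 d) (extForm 𝓑 d ℓ) t i

/-- The integers `q` with `max(0, d - t) ≤ q ≤ min(d - 1, d - 1 - i - t + s, i)`. -/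
def qRange (d t i s : ℕ) : Finset ℕ :=
  {q ∈ Finset.range d | d ≤ q + t ∧ q + i + t ≤ d - 1 + s ∧ q ≤ i}

/-- `|det C_{t,p,d}|` as an element of `k`. -/
def absDetC (k : Type*) [Field k] (t p d : ℕ) : k := ((|(matC t p d).det| : ℤ) : k)

/-- `dim_k B_j` for an integer `j`. -/
noncomputable def hdim {k R : Type*} [Field k] [CommRing R] [Algebra k R]
    (𝓡 : ℕ → Submodule k R) (j : ℤ) : ℕ :=
  Module.finrank k (gr 𝓡 j)

/-- The factor `F₂`. -/
noncomputable def factorTwo {k B : Type*} [Field k] [CommRing B] [Algebra k B]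
    (𝓑 : ℕ → Submodule k B) (d t i s : ℕ) : k :=
  ∏ p ∈ Finset.Icc (max 1 (max (1 + i + t - s) (d - i - 1))) (min (d - 1) (t - 1)),
    absDetC k t p d ^
      ((hdim 𝓑 ((i : ℤ) + p - (d - 1)) : ℤ) - (hdim 𝓑 ((i : ℤ) + p - d) : ℤ))

/-- The factor `F₃`.  The inequalities are between integers; when they hold, `i + t - s` is
nonnegative. -/
noncomputable def factorThree {k B : Type*} [Field k] [CommRing B] [Algebra k B]
    (𝓑 : ℕ → Submodule k B) (d t i s : ℕ) : k :=
  if (i : ℤ) + t - s ≤ min ((d : ℤ) - 1) ((t : ℤ) - 1) ∧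
      max 0 ((d : ℤ) - 1 - i) ≤ (i : ℤ) + t - s then
    absDetC k t (i + t - s) d ^ hdim 𝓑 (2 * (i : ℤ) - (d - 1) + t - s)
  else 1

/-! Split `A_i` into the blocks `B_{i-b} x^b`. By the binomial theorem, `ℓ^t` is a block matrix
whose block `(a, b)` is `binom t (a - b)` times the power `t + b - a` of the linear form of `B`.
Exponents add under composition, so column operations on the scalar matrix lift to automorphisms of
the source.

Reorder the target blocks by `pairRow`. Column `q` is paired with row `q + t` if `q + t < d`, where
the power is zero and the coefficient is one, and with row `d - 1 - q` otherwise, where the power is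
`2q + t - (d - 1)`, as in the maps (3). The leading principal minors of the reordered scalar matrix
are 1 up to order `d - t` and `± det C_{t,d-r,d}` in order `r` from there on. While they do not
vanish, an upper unitriangular matrix brings the rows to lower triangular form, with quotients of
consecutive minors as pivots (`exists_isColReduction`, `exists_isEchelon`). These minors are nonzero
in characteristic zero because a polynomial with at most `t` terms is not divisible by `(X + 1)^t`
unless it is zero (`det_matC_ne_zero`).

Blocks outside the range of paired indices vanish all in the source or all in the target
(`IsSocleDegree.eq_bot_or_eq_bot`), so only the paired rows need pivots. Whatever stands below a
diagonal block factors through it (`IsEchelon.smul_eq_zero`), so with nonzero pivots the whole map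
is injective or surjective exactly if all diagonal blocks are. Condition (1) controls every pivot
except possibly the last. Full rank of `ℓ^t` still passes to the diagonal blocks if that pivot is
zero; the converse needs it to be nonzero, which is what (2) provides.

For the determinant, the diagonal block `q` contributes its pivot to the power `dim B_{i-q}` times
the determinant of the map (3). Since pivots are quotients of minors, summation by parts turns their
product into `F₂` and the boundary term `F₃` (`prod_qRange_pivots`). Reorderings of bases only
affect signs, so all identities are proved for squares. -/

/-! ### The determinants of `C_{t,p,d}` in characteristic zero. -/

/-- A nonzero polynomial with at most `n` terms over a domain of characteristic zero is not
divisible by `(X + 1) ^ n`. -/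
theorem Polynomial.eq_zero_of_X_add_one_pow_dvd {R : Type*} [CommRing R] [IsDomain R] [CharZero R]
    (n : ℕ) (g : R[X]) (hg : g.support.card ≤ n) (hdvd : (X + 1 : R[X]) ^ n ∣ g) : g = 0 := by
  induction n generalizing g with
  | zero => exact Polynomial.support_eq_empty.1 (Finset.card_eq_zero.1 (Nat.le_zero.1 hg))
  | succ n ih =>
    by_contra hne
    obtain ⟨j, hj⟩ := Polynomial.nonempty_support_iff.2 hne
    -- The operator `X d/dX - j` deletes the term of degree `j` and lowers the order of vanishing at
    -- `-1` by at most one, so induction applies to the image.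
    have hcoeff : ∀ m : ℕ, (X * derivative g - (j : R[X]) * g).coeff m = ((m : R) - j) * g.coeff m := by
      intro m
      rw [coeff_sub, coeff_natCast_mul]
      cases m with
      | zero => simp
      | succ m => rw [coeff_X_mul, coeff_derivative]; push_cast; ring
    have h0 : X * derivative g - (j : R[X]) * g = 0 := by
      apply ih
      · have hsub : (X * derivative g - (j : R[X]) * g).support ⊆ g.support.erase j := by
          intro m hm
          rw [mem_support_iff, hcoeff] at hm
          refine Finset.mem_erase.2 ⟨?_, mem_support_iff.2 (right_ne_zero_of_mul hm)⟩
          rintro rfl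
          simp at hm
        have h1 := Finset.card_le_card hsub
        rw [Finset.card_erase_of_mem hj] at h1
        omega
      · obtain ⟨f, rfl⟩ := hdvd
        refine dvd_sub (Dvd.dvd.mul_left ?_ _) (Dvd.dvd.mul_left ?_ _)
        · rw [derivative_mul, derivative_pow]
          refine dvd_add ?_ ?_
          · simp only [Nat.add_sub_cancel]
            exact Dvd.intro_left (C ((n + 1 : ℕ) : R) * derivative (X + 1) * f) (by ring)
          · exact Dvd.intro_left ((X + 1) * derivative f) (by ring)
        · exact Dvd.intro_left ((X + 1) * f) (by ring)
    -- In characteristic zero the operator kills only multiples of `X^j`, and a nonzero monomial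
    -- does not vanish at `-1`.
    have hmono : g = monomial j (g.coeff j) := by
      ext m
      rw [coeff_monomial]
      split_ifs with h
      · rw [h]
      · have h1 := hcoeff m
        rw [h0, coeff_zero] at h1
        rcases mul_eq_zero.1 h1.symm with h2 | h2
        · exact absurd (Nat.cast_injective (sub_eq_zero.1 h2)).symm h
        · exact h2
    obtain ⟨f, hf⟩ := hdvd
    have hev := congrArg (eval (-1)) hf
    rw [hmono] at hev
    simp at hev
    exact mem_support_iff.1 hj hev

theorem binom_natCast_sub (t a b : ℕ) :
    binom t ((a : ℤ) - b) = if b ≤ a then (t.choose (a - b) : ℤ) else 0 := by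
  unfold binom
  by_cases h : b ≤ a
  · rw [if_pos (by omega), if_pos h]
    congr 2
    omega
  · rw [if_neg (by omega), if_neg h]

/-- Read a kernel vector as a polynomial `f` of degree less than `d - p`. Row `r` of the matrix
computes the coefficient of degree `d - 1 - r` in `f (X + 1)^t`, so the degrees from `p` to `d - 1`
are missing. Below them are `p` degrees and above them `t - p`, which leaves at most `t` terms. -/
theorem det_matC_ne_zero (t p d : ℕ) (hpt : p ≤ t) (hpd : p ≤ d) : (matC t p d).det ≠ 0 := by
  intro h
  obtain ⟨v, hv, hmul⟩ := Matrix.exists_mulVec_eq_zero_iff.2 h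
  apply hv
  let f : ℤ[X] := ∑ b : Fin (d - p), Polynomial.C (v b) * Polynomial.X ^ (b : ℕ)
  have hcoeff : ∀ n : ℕ, (f * (Polynomial.X + 1) ^ t).coeff n =
      ∑ b : Fin (d - p), v b * binom t ((n : ℤ) - (b : ℕ)) := by
    intro n
    rw [Finset.sum_mul, Polynomial.finsetSum_coeff]
    refine Finset.sum_congr rfl fun b _ => ?_
    rw [mul_assoc, Polynomial.coeff_C_mul, Polynomial.coeff_X_pow_mul', binom_natCast_sub]
    split_ifs
    · rw [Polynomial.coeff_X_add_one_pow]
    · rfl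
  have hfz : f * (Polynomial.X + 1) ^ t = 0 := by
    apply Polynomial.eq_zero_of_X_add_one_pow_dvd t _ _ (Dvd.intro_left _ rfl)
    have hsub : (f * (Polynomial.X + 1) ^ t).support ⊆
        Finset.range p ∪ Finset.Ico d (d + (t - p)) := by
      intro n hn
      rw [Polynomial.mem_support_iff, hcoeff] at hn
      rw [Finset.mem_union, Finset.mem_range, Finset.mem_Ico]
      by_contra hcon
      push Not at hcon
      apply hn
      by_cases hnd : n < d
      · have hrow := congrFun hmul ⟨d - 1 - n, by omega⟩
        rw [Matrix.mulVec, dotProduct] at hrow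
        simp only [Pi.zero_apply] at hrow
        rw [← hrow]
        refine Finset.sum_congr rfl fun b _ => ?_
        rw [mul_comm]
        simp only [matC, Matrix.of_apply]
        congr 2
        omega
      · have := hcon.2 (by omega)
        refine Finset.sum_eq_zero fun b _ => ?_
        have := b.2
        rw [binom_natCast_sub]
        split_ifs
        · rw [Nat.choose_eq_zero_of_lt (by omega)]
          simp
        · simp
    refine (Finset.card_le_card hsub).trans ((Finset.card_union_le _ _).trans ?_)
    simp
    omega
  have hf : f = 0 := by
    rcases mul_eq_zero.1 hfz with h1 | h1
    · exact h1
    · exact absurd h1 (pow_ne_zero _ (Polynomial.X_add_C_ne_zero (1 : ℤ)))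
  funext b
  have hb := congrArg (fun g => Polynomial.coeff g (b : ℕ)) hf
  simp only [f, Polynomial.finsetSum_coeff, Polynomial.coeff_C_mul, Polynomial.coeff_X_pow,
    Polynomial.coeff_zero] at hb
  rw [Finset.sum_eq_single b] at hb
  · simpa using hb
  · intro c _ hc
    rw [if_neg (fun h => hc (Fin.ext h.symm)), mul_zero]
  · simp

/-! ### Column reduction and leading minors. -/

/-- The leading principal minor of order `r`. -/
def leadMinor {R : Type*} [CommRing R] (H : ℕ → ℕ → R) (r : ℕ) : R :=
  (Matrix.of fun a b : Fin r => H a b).det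

/-- The entry `(a, q)` of the product of `H` with an upper triangular matrix `U`. -/
def colProd {R : Type*} [CommRing R] (H U : ℕ → ℕ → R) (a q : ℕ) : R :=
  ∑ b ∈ Finset.range (q + 1), H a b * U b q

/-- `U` is an upper unitriangular matrix such that the rows of `H * U` of index less than `N` are
lower triangular. -/
structure IsColReduction {R : Type*} [CommRing R] (H U : ℕ → ℕ → R) (N : ℕ) : Prop where
  diag : ∀ q, U q q = 1
  upper : ∀ b q, q < b → U b q = 0
  lower : ∀ a q, a < q → a < N → colProd H U a q = 0

theorem exists_isColReduction {k : Type*} [Field k] (H : ℕ → ℕ → k) (N : ℕ)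
    (hN : ∀ r ≤ N, leadMinor H r ≠ 0) : ∃ U, IsColReduction H U N := by
  have key : ∀ q, ∃ x : ℕ → k, x q = 1 ∧ (∀ b, q < b → x b = 0) ∧
      ∀ a, a < q → a < N → ∑ b ∈ Finset.range (q + 1), H a b * x b = 0 := by
    intro q
    -- Column `q` needs zeros in the rows below both `q` and `N`. Its first `r` entries solve the
    -- corresponding square system, which is invertible by the minor of order `r`.
    set r := min q N with hr
    have hrq : r ≤ q := min_le_left _ _
    have hdet : IsUnit (Matrix.of fun a b : Fin r => H a b).det :=
      isUnit_iff_ne_zero.2 (hN r (min_le_right _ _))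
    set y : Fin r → k := (Matrix.of fun a b : Fin r => H a b)⁻¹.mulVec fun a => -H a q with hy
    have hy' : ∀ a : Fin r, ∑ b : Fin r, H a b * y b = -H a q := by
      intro a
      have h1 : (Matrix.of fun a b : Fin r => H a b).mulVec y = fun a : Fin r => -H a q := by
        rw [hy, Matrix.mulVec_mulVec, Matrix.mul_nonsing_inv _ hdet, Matrix.one_mulVec]
      exact congrFun h1 a
    refine ⟨fun b => if b = q then 1 else if h : b < r then y ⟨b, h⟩ else 0, by simp, ?_, ?_⟩
    · intro b hb
      simp only []
      rw [if_neg (by omega), dif_neg (by omega)]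
    · intro a haq haN
      simp only []
      rw [Finset.sum_range_succ, if_pos rfl, mul_one]
      have h1 : ∑ b ∈ Finset.range q, H a b *
          (if b = q then 1 else if h : b < r then y ⟨b, h⟩ else 0) =
          ∑ b ∈ Finset.range r, H a b * (if h : b < r then y ⟨b, h⟩ else 0) := by
        symm
        rw [Finset.sum_subset (Finset.range_mono hrq)]
        · refine Finset.sum_congr rfl fun b hb => ?_
          rw [if_neg (Finset.mem_range.1 hb).ne]
        · intro b _ hb
          rw [dif_neg (by simpa using hb), mul_zero]
      have h2 := hy' ⟨a, by omega⟩
      rw [h1, Finset.sum_range]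
      simp only [Fin.is_lt, dif_pos, Fin.eta]
      rw [h2]
      simp
  choose x h1 h2 h3 using key
  exact ⟨fun b q => x q b, h1, fun b q h => h2 q b h, fun a q h h' => h3 q a h h'⟩

/-- Multiplying by a unitriangular matrix keeps leading minors. The order `N + 1` is allowed because
the last row of that minor has no entry right of the diagonal; this gives access to pivot `N` even
when it is zero. -/
theorem IsColReduction.leadMinor_eq_prod {R : Type*} [CommRing R] {H U : ℕ → ℕ → R} {N : ℕ}
    (hU : IsColReduction H U N) (r : ℕ) (hr : r ≤ N + 1) :
    leadMinor H r = ∏ a ∈ Finset.range r, colProd H U a a := by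
  have hmul : (Matrix.of fun a b : Fin r => H a b) * (Matrix.of fun a b : Fin r => U a b) =
      Matrix.of fun a b : Fin r => colProd H U a b := by
    ext a q
    rw [Matrix.mul_apply]
    simp only [Matrix.of_apply, colProd]
    rw [← Finset.sum_range fun b => H a b * U b q]
    symm
    apply Finset.sum_subset (Finset.range_mono q.2)
    intro b _ hb
    rw [hU.upper b q (by simpa using hb), mul_zero]
  have h1 := congrArg Matrix.det hmul
  rw [Matrix.det_mul, Matrix.det_of_isUpperTriangular (M := Matrix.of fun a b : Fin r => U a b),
    Matrix.det_of_isLowerTriangular (Matrix.of fun a b : Fin r => colProd H U a b)] at h1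
  · simp only [Matrix.of_apply, hU.diag, Finset.prod_const_one, mul_one] at h1
    rw [leadMinor, h1, Finset.prod_range]
  · intro a b hab
    exact hU.lower a b hab (by have := b.2; simp at hab; omega)
  · intro a b hab
    exact hU.upper a b hab

theorem IsColReduction.leadMinor_succ {R : Type*} [CommRing R] {H U : ℕ → ℕ → R} {N : ℕ}
    (hU : IsColReduction H U N) (r : ℕ) (hr : r ≤ N) :
    leadMinor H (r + 1) = leadMinor H r * colProd H U r r := by
  rw [hU.leadMinor_eq_prod _ (by omega), hU.leadMinor_eq_prod _ (by omega),
    Finset.prod_range_succ]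

/-! ### The reordered binomial matrix and its minors. -/

/-- The row of the block matrix of `ℓ ^ t` which is paired with the column `a`. -/
def pairRow (d t a : ℕ) : ℕ := if a + t < d then a + t else d - 1 - a

/-- The binomial coefficients of the block matrix of `ℓ ^ t`, with the rows permuted by
`pairRow`. -/
def pairedBinom (d t a b : ℕ) : ℤ := binom t ((pairRow d t a : ℤ) - b)

/-- These rows have entries `binom t (t + a - b)`, which are upper unitriangular. -/
theorem leadMinor_pairedBinom_of_le (d t r : ℕ) (hr : r ≤ d - t) :
    leadMinor (pairedBinom d t) r = 1 := by
  rw [leadMinor, Matrix.det_of_isUpperTriangular]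
  · refine Finset.prod_eq_one fun a _ => ?_
    have := a.2
    simp only [Matrix.of_apply, pairedBinom, pairRow]
    rw [if_pos (by omega), binom_natCast_sub, if_pos (by omega)]
    simp
  · intro a b hab
    have := a.2
    have hab' : (b : ℕ) < a := hab
    simp only [Matrix.of_apply, pairedBinom, pairRow]
    rw [if_pos (by omega), binom_natCast_sub, if_pos (by omega),
      Nat.choose_eq_zero_of_lt (by omega)]
    simp

theorem leadMinor_pairedBinom_sq (d t r : ℕ) (hr : d - t ≤ r) (hrd : r ≤ d) :
    leadMinor (pairedBinom d t) r ^ 2 = (matC t (d - r) d).det ^ 2 := by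
  have hr' : d - (d - r) = r := by omega
  -- Row `a` with `a + t < d` is row `d - 1 - t - a` of `C`, and every other row keeps its index.
  -- Reversing the first `d - t` indices is an involution, and it stays inside `Fin r` because `d -
  -- t ≤ r`.
  let f : Fin r → Fin r := fun a => if h : (a : ℕ) + t < d then ⟨d - 1 - t - a, by omega⟩ else a
  have hf : Function.Involutive f := by
    intro a
    have := a.2
    apply Fin.ext
    by_cases h : (a : ℕ) + t < d
    · have h1 : f a = ⟨d - 1 - t - a, by omega⟩ := dif_pos h
      have h2 : (d - 1 - t - (a : ℕ)) + t < d := by omega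
      rw [h1]
      simp only [f, dif_pos h2]
      omega
    · have h1 : f a = a := dif_neg h
      rw [h1, h1]
  have key : (Matrix.of fun a b : Fin r => pairedBinom d t a b) =
      ((matC t (d - r) d).submatrix (finCongr hr'.symm) (finCongr hr'.symm)).submatrix
        (Function.Involutive.toPerm f hf) id := by
    ext a b
    have := a.2
    simp only [Matrix.of_apply, Matrix.submatrix_apply, matC, pairedBinom, pairRow,
      Function.Involutive.coe_toPerm, id, finCongr_apply, Fin.val_cast]
    congr 1
    by_cases h : (a : ℕ) + t < d
    · have h1 : f a = ⟨d - 1 - t - a, by omega⟩ := dif_pos h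
      rw [h1, if_pos h]
      simp only []
      omega
    · have h1 : f a = a := dif_neg h
      rw [h1, if_neg h]
      omega
  rw [leadMinor, key, Matrix.det_permute, Matrix.det_submatrix_equiv_self, mul_pow,
    ← Int.cast_pow, ← Units.val_pow_eq_pow_val, Int.units_sq]
  simp

/-- Reversing the rows gives the entries `binom t (a - b)`, a lower unitriangular matrix. This
covers the order `d`, for which the characteristic conditions say nothing. -/
theorem det_matC_zero_sq (t d : ℕ) : (matC t 0 d).det ^ 2 = 1 := by
  have key : ((matC t 0 d).submatrix Fin.revPerm id).det = 1 := by
    rw [Matrix.det_of_isLowerTriangular]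
    · refine Finset.prod_eq_one fun a _ => ?_
      have := a.2
      simp only [Matrix.submatrix_apply, matC, Matrix.of_apply, Fin.revPerm_apply, Fin.val_rev, id]
      rw [show (d : ℤ) - 1 - ((d - 0 - (↑a + 1) : ℕ) : ℤ) - (a : ℕ) = ((0 : ℕ) : ℤ) - ((0 : ℕ) : ℤ)
        by omega, binom_natCast_sub]
      simp
    · intro a b hab
      have hab' : (a : ℕ) < b := hab
      have := a.2
      simp only [Matrix.submatrix_apply, matC, Matrix.of_apply, Fin.revPerm_apply, Fin.val_rev, id]
      rw [show (d : ℤ) - 1 - ((d - 0 - (↑a + 1) : ℕ) : ℤ) - (b : ℕ) = ((a : ℕ) : ℤ) - (b : ℕ)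
        by omega, binom_natCast_sub, if_neg (by omega)]
  rw [Matrix.det_permute] at key
  have h := congrArg (· ^ 2) key
  simp only [mul_pow, one_pow] at h
  rwa [← Int.cast_pow, ← Units.val_pow_eq_pow_val, Int.units_sq, Units.val_one, Int.cast_one,
    one_mul] at h

theorem leadMinor_intCast {R : Type*} [CommRing R] (H : ℕ → ℕ → ℤ) (r : ℕ) :
    leadMinor (fun a b => (H a b : R)) r = ((leadMinor H r : ℤ) : R) := by
  exact (RingHom.map_det (Int.castRingHom R) (Matrix.of fun a b : Fin r => H a b)).symm

/-! ### Graded pieces and full rank. -/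

theorem mul_mem_gr {k R : Type*} [Field k] [CommRing R] [Algebra k R]
    (𝓡 : ℕ → Submodule k R) [SetLike.GradedMonoid 𝓡] {m n : ℤ} {x y : R}
    (hx : x ∈ gr 𝓡 m) (hy : y ∈ gr 𝓡 n) : x * y ∈ gr 𝓡 (m + n) := by
  unfold gr at hx hy ⊢
  split_ifs at hx hy with h1 h2
  · rw [if_pos (by omega), Int.toNat_add h1 h2]
    exact SetLike.mul_mem_graded hx hy
  · rw [(Submodule.mem_bot k).1 hy, mul_zero]
    exact Submodule.zero_mem _
  all_goals
    rw [(Submodule.mem_bot k).1 hx, zero_mul]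
    exact Submodule.zero_mem _

theorem pow_mem_gr {k R : Type*} [Field k] [CommRing R] [Algebra k R]
    (𝓡 : ℕ → Submodule k R) [SetLike.GradedMonoid 𝓡] (ℓ : 𝓡 1) (m : ℕ) :
    (ℓ : R) ^ m ∈ gr 𝓡 m := by
  rw [gr, if_pos (by omega), Int.toNat_natCast]
  simpa using SetLike.pow_mem_graded m ℓ.2

theorem gr_eq_bot_of_neg {k R : Type*} [Field k] [CommRing R] [Algebra k R]
    (𝓡 : ℕ → Submodule k R) {j : ℤ} (hj : j < 0) : gr 𝓡 j = ⊥ :=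
  if_neg (by omega)

theorem IsSocleDegree.gr_eq_bot {k B : Type*} [Field k] [CommRing B] [Algebra k B]
    {𝓑 : ℕ → Submodule k B} {s : ℕ} (hs : IsSocleDegree 𝓑 s) {j : ℤ} (hj : (s : ℤ) < j) :
    gr 𝓑 j = ⊥ := by
  rw [gr, if_pos (by omega)]
  by_contra h
  have := hs.2 h
  omega

/-- Products of linear forms span `B`, and once such a product reaches degree `m` it is zero. Hence
no degree between 0 and the socle degree is skipped. -/
theorem IsStandardGradedArtinian.eq_bot_of_le {k B : Type*} [Field k] [CommRing B] [Algebra k B]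
    {𝓑 : ℕ → Submodule k B} [GradedAlgebra 𝓑] (hB : IsStandardGradedArtinian 𝓑) {m n : ℕ}
    (hmn : m ≤ n) (hm : 𝓑 m = ⊥) : 𝓑 n = ⊥ := by
  have hclosure : ∀ x ∈ Submonoid.closure (𝓑 1 : Set B), ∃ j, x ∈ 𝓑 j ∧ (m ≤ j → x = 0) := by
    intro x hx
    induction hx using Submonoid.closure_induction_right with
    | one =>
      refine ⟨0, SetLike.one_mem_graded 𝓑, fun h => ?_⟩
      obtain rfl : m = 0 := by omega
      exact (Submodule.mem_bot k).1 (hm ▸ SetLike.one_mem_graded 𝓑)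
    | mul_right x _ y hy ih =>
      obtain ⟨j, hj, hj'⟩ := ih
      have hxy : x * y ∈ 𝓑 (j + 1) := SetLike.mul_mem_graded hj hy
      refine ⟨j + 1, hxy, fun h => ?_⟩
      by_cases h1 : m ≤ j
      · rw [hj' h1, zero_mul]
      · obtain rfl : m = j + 1 := by omega
        exact (Submodule.mem_bot k).1 (hm ▸ hxy)
  have hproj : ∀ x : B, (DirectSum.decompose 𝓑 x n : B) = 0 := by
    intro x
    have hx : x ∈ Submodule.span k (Submonoid.closure (𝓑 1 : Set B) : Set B) := by
      rw [← Algebra.adjoin_eq_span, hB.generated]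
      trivial
    induction hx using Submodule.span_induction with
    | zero => simp
    | add x y _ _ hx hy => simp [hx, hy]
    | smul c x _ hx => rw [DirectSum.decompose_smul]; simp [DirectSum.smul_apply, hx]
    | mem x hx =>
      obtain ⟨j, hj, hj'⟩ := hclosure x hx
      by_cases h : j = n
      · rw [hj' (by omega)]
        simp
      · exact DirectSum.decompose_of_mem_ne 𝓑 hj h
  rw [eq_bot_iff]
  intro x hx
  rw [Submodule.mem_bot, ← hproj x, DirectSum.decompose_of_mem_same 𝓑 hx]

theorem IsStandardGradedArtinian.gr_ne_bot {k B : Type*} [Field k] [CommRing B] [Algebra k B]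
    {𝓑 : ℕ → Submodule k B} [GradedAlgebra 𝓑] (hB : IsStandardGradedArtinian 𝓑) {s : ℕ}
    (hs : IsSocleDegree 𝓑 s) {j : ℤ} (hj : 0 ≤ j) (hjs : j ≤ s) : gr 𝓑 j ≠ ⊥ := by
  rw [gr, if_pos hj]
  intro h
  exact hs.1 (hB.eq_bot_of_le (by omega) h)

theorem hasFullRank_iff {k V W : Type*} [Field k] [AddCommGroup V] [Module k V] [AddCommGroup W]
    [Module k W] [Module.Finite k V] [Module.Finite k W] (f : V →ₗ[k] W) :
    HasFullRank f ↔ Function.Injective f ∨ Function.Surjective f := by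
  unfold HasFullRank
  have h1 := LinearMap.finrank_range_add_finrank_ker f
  have h2 := Submodule.finrank_le (LinearMap.range f)
  constructor
  · intro h
    rcases le_total (Module.finrank k V) (Module.finrank k W) with hle | hle
    · left
      rw [← LinearMap.ker_eq_bot, ← Submodule.finrank_eq_zero (R := k)]
      rw [min_eq_left hle] at h
      omega
    · right
      rw [min_eq_right hle] at h
      exact LinearMap.range_eq_top.1 (Submodule.eq_top_of_finrank_eq h)
  · rintro (h | h)
    · rw [← LinearMap.ker_eq_bot] at h
      rw [h, finrank_bot] at h1
      omega
    · rw [LinearMap.range_eq_top.2 h, finrank_top] at h1 ⊢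
      omega

/-! ### Scalar matrices weighted by powers of a linear form. -/

/-- The map `⨁ R_{f b} → ⨁ R_{g a}` whose component from `b` to `a` is multiplication by
`c a b • ℓ ^ (e a b)`. -/
def weightedMap {k R : Type*} [Field k] [CommRing R] [Algebra k R]
    (𝓡 : ℕ → Submodule k R) [SetLike.GradedMonoid 𝓡] (ℓ : 𝓡 1) {n : ℕ} (f g : Fin n → ℤ)
    (c : Fin n → Fin n → k) (e : Fin n → Fin n → ℕ)
    (h : ∀ a b, c a b ≠ 0 → f b + e a b = g a) :
    (∀ b, gr 𝓡 (f b)) →ₗ[k] ∀ a, gr 𝓡 (g a) where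
  toFun v a := ⟨∑ b, c a b • ((ℓ : R) ^ e a b * v b), Submodule.sum_mem _ fun b _ => by
    by_cases hc : c a b = 0
    · rw [hc, zero_smul]
      exact Submodule.zero_mem _
    · rw [← h a b hc, add_comm]
      exact Submodule.smul_mem _ _ (mul_mem_gr 𝓡 (pow_mem_gr 𝓡 ℓ _) (v b).2)⟩
  map_add' v w := by
    funext a
    apply Subtype.ext
    simp [mul_add, smul_add, Finset.sum_add_distrib]
  map_smul' r v := by
    funext a
    apply Subtype.ext
    simp [Finset.smul_sum, smul_comm r]

section WeightedMap

variable {k R : Type*} [Field k] [CommRing R] [Algebra k R]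
  (𝓡 : ℕ → Submodule k R) [SetLike.GradedMonoid 𝓡] (ℓ : 𝓡 1) {n : ℕ}

theorem weightedMap_apply (f g : Fin n → ℤ) (c : Fin n → Fin n → k) (e : Fin n → Fin n → ℕ)
    (h : ∀ a b, c a b ≠ 0 → f b + e a b = g a) (v : ∀ b, gr 𝓡 (f b)) (a : Fin n) :
    (weightedMap 𝓡 ℓ f g c e h v a : R) = ∑ b, c a b • ((ℓ : R) ^ e a b * v b) :=
  rfl

theorem weightedMap_single (f g : Fin n → ℤ) (c : Fin n → Fin n → k) (e : Fin n → Fin n → ℕ)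
    (h : ∀ a b, c a b ≠ 0 → f b + e a b = g a) (b : Fin n) (v : gr 𝓡 (f b)) (a : Fin n) :
    (weightedMap 𝓡 ℓ f g c e h (Pi.single b v) a : R) = c a b • ((ℓ : R) ^ e a b * v) := by
  rw [weightedMap_apply, Finset.sum_eq_single b]
  · rw [Pi.single_eq_same]
  · intro b' _ hb'
    rw [Pi.single_eq_of_ne hb']
    simp
  · simp

theorem weightedMap_comp (f g g' : Fin n → ℤ) (c c' c'' : Fin n → Fin n → k)
    (e e' e'' : Fin n → Fin n → ℕ) (h : ∀ a b, c a b ≠ 0 → f b + e a b = g a)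
    (h' : ∀ a b, c' a b ≠ 0 → g b + e' a b = g' a)
    (h'' : ∀ a b, c'' a b ≠ 0 → f b + e'' a b = g' a)
    (hc : ∀ a b, c'' a b = ∑ q, c' a q * c q b)
    (he : ∀ a q b, c' a q ≠ 0 → c q b ≠ 0 → e' a q + e q b = e'' a b) :
    weightedMap 𝓡 ℓ g g' c' e' h' ∘ₗ weightedMap 𝓡 ℓ f g c e h =
      weightedMap 𝓡 ℓ f g' c'' e'' h'' := by
  refine LinearMap.ext fun v => funext fun a => Subtype.ext ?_
  rw [LinearMap.comp_apply, weightedMap_apply, weightedMap_apply]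
  simp only [weightedMap_apply, Finset.mul_sum, Finset.smul_sum]
  rw [Finset.sum_comm]
  refine Finset.sum_congr rfl fun b _ => ?_
  rw [hc, Finset.sum_smul]
  refine Finset.sum_congr rfl fun q _ => ?_
  by_cases h1 : c' a q = 0
  · rw [h1, zero_mul, zero_smul, zero_smul]
  by_cases h2 : c q b = 0
  · rw [h2, zero_smul, mul_zero, mul_zero, zero_smul, smul_zero]
  rw [← he a q b h1 h2, mul_smul_comm, smul_smul, pow_add, mul_assoc]

/-- An upper unitriangular weighted map is bijective. -/
theorem weightedMap_bijective [Module.Finite k R] (f : Fin n → ℤ) (c : Fin n → Fin n → k)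
    (e : Fin n → Fin n → ℕ) (h : ∀ a b, c a b ≠ 0 → f b + e a b = f a)
    (hdiag : ∀ a, c a a = 1) (hupper : ∀ a b, b < a → c a b = 0) :
    Function.Bijective (weightedMap 𝓡 ℓ f f c e h) := by
  have hinj : Function.Injective (weightedMap 𝓡 ℓ f f c e h) := by
    rw [← LinearMap.ker_eq_bot, LinearMap.ker_eq_bot']
    intro v hv
    -- Back substitution from the last coordinate; the degree condition forces exponent zero on the
    -- diagonal.
    have key : ∀ m : ℕ, ∀ a : Fin n, n ≤ a + m → (v a : R) = 0 := by
      intro m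
      induction m with
      | zero => intro a ha; have := a.2; omega
      | succ m ih =>
        intro a ha
        have h1 : (weightedMap 𝓡 ℓ f f c e h v a : R) = 0 := by rw [hv]; rfl
        rw [weightedMap_apply, Finset.sum_eq_single a] at h1
        · have h2 : e a a = 0 := by
            have := h a a (by rw [hdiag]; exact one_ne_zero)
            omega
          simpa [hdiag, h2] using h1
        · intro b _ hb
          rcases lt_or_gt_of_ne hb with h2 | h2
          · rw [hupper a b h2, zero_smul]
          · rw [ih b (by have : (a : ℕ) < b := h2; omega), mul_zero, smul_zero]
        · simp
    funext a
    exact Subtype.ext (key n a (by omega))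
  exact ⟨hinj, LinearMap.injective_iff_surjective.1 hinj⟩

end WeightedMap

/-! ### The block matrix of `ℓ^t`. -/

theorem coe_extEquiv {k B : Type*} [Field k] [CommRing B] [Algebra k B]
    (𝓑 : ℕ → Submodule k B) (d : ℕ) (j : ℤ) (v : ∀ m : Fin d, gr 𝓑 (j - (m : ℕ))) :
    (extEquiv 𝓑 d j v : TruncExt k B d) =
      ∑ m : Fin d, (v m : B) ⊗ₜ[k] (truncX k d ^ (m : ℕ)) :=
  extSum_apply 𝓑 d j v

/-- A nonzero coefficient forces `a ≤ t + b`, so the exponent `t + b - a` is not truncated. -/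
theorem binom_sub_weight {k : Type*} [Field k] {t : ℕ} {i : ℤ} {a b : ℕ}
    (h : ((binom t ((a : ℤ) - b) : ℤ) : k) ≠ 0) :
    i - (b : ℤ) + ((t + b - a : ℕ) : ℤ) = i + t - (a : ℕ) := by
  rw [binom_natCast_sub] at h
  split_ifs at h with h1
  · have h2 : a - b ≤ t := by
      by_contra hcon
      rw [Nat.choose_eq_zero_of_lt (by omega)] at h
      simp at h
    omega
  · simp at h

section ExtMap

variable {k B : Type*} [Field k] [CommRing B] [Algebra k B]
  (𝓑 : ℕ → Submodule k B) [GradedAlgebra 𝓑] (ℓ : 𝓑 1)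

theorem extForm_pow_mul (d t m : ℕ) (v : B) :
    (extForm 𝓑 d ℓ : TruncExt k B d) ^ t * (v ⊗ₜ[k] (truncX k d ^ m)) =
      ∑ m' : Fin d, (((binom t (((m' : ℕ) : ℤ) - m) : ℤ) : k) • ((ℓ : B) ^ (t + m - m') * v)) ⊗ₜ[k]
        (truncX k d ^ (m' : ℕ)) := by
  have h1 : (extForm 𝓑 d ℓ : TruncExt k B d) = 1 ⊗ₜ[k] truncX k d + (ℓ : B) ⊗ₜ[k] 1 :=
    add_comm _ _
  rw [Finset.sum_fin_eq_sum_range, h1, add_pow, Finset.sum_mul]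
  have h2 : ∀ m' ∈ Finset.range d, (if h : m' < d then
        (((binom t (((⟨m', h⟩ : Fin d) : ℕ) - (m : ℤ)) : ℤ) : k) •
          ((ℓ : B) ^ (t + m - ((⟨m', h⟩ : Fin d) : ℕ)) * v)) ⊗ₜ[k]
          (truncX k d ^ ((⟨m', h⟩ : Fin d) : ℕ)) else 0) =
      (((binom t ((m' : ℤ) - m) : ℤ) : k) • ((ℓ : B) ^ (t + m - m') * v)) ⊗ₜ[k]
        (truncX k d ^ m') := by
    intro m' hm'
    rw [dif_pos (Finset.mem_range.1 hm')]
  rw [Finset.sum_congr rfl h2]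
  -- A common range for both sums: the added powers of `x` on the right are zero, and the binomial
  -- coefficients vanish below `m` and above `m + t`.
  have h3 : Finset.range d ⊆ Finset.range (m + ((t + 1) + d)) := Finset.range_mono (by omega)
  rw [Finset.sum_subset h3, Finset.sum_range_add _ m (t + 1 + d),
    Finset.sum_eq_zero (s := Finset.range m), zero_add, Finset.sum_range_add _ (t + 1) d,
    Finset.sum_eq_zero (s := Finset.range d), add_zero]
  · refine Finset.sum_congr rfl fun j hj => ?_
    rw [binom_natCast_sub, if_pos (by omega), Nat.add_sub_cancel_left,
      show t + m - (m + j) = t - j by omega, Algebra.TensorProduct.tmul_pow,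
      Algebra.TensorProduct.tmul_pow, one_pow, one_pow, Algebra.TensorProduct.tmul_mul_tmul,
      one_mul, mul_one, mul_comm _ ((t.choose j : ℕ) : TruncExt k B d), mul_assoc,
      Algebra.TensorProduct.tmul_mul_tmul, ← pow_add, add_comm j m, ← TensorProduct.smul_tmul',
      Int.cast_natCast, Nat.cast_smul_eq_nsmul, nsmul_eq_mul]
  · intro j _
    rw [binom_natCast_sub, if_pos (by omega), Nat.choose_eq_zero_of_lt (by omega)]
    simp
  · intro j hj
    rw [binom_natCast_sub, if_neg (by simpa using hj)]
    simp
  · intro j _ hj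
    rw [truncX_pow_eq_zero k d j (by simpa using hj), TensorProduct.tmul_zero]

theorem extMap_extEquiv (d t i : ℕ) (v : ∀ m : Fin d, gr 𝓑 ((i : ℤ) - (m : ℕ))) :
    extMap 𝓑 ℓ d t i (extEquiv 𝓑 d i v) = extEquiv 𝓑 d ((i : ℤ) + t)
      (weightedMap 𝓑 ℓ (fun m : Fin d => (i : ℤ) - (m : ℕ))
        (fun m : Fin d => (i : ℤ) + (t : ℤ) - (m : ℕ))
        (fun a b => ((binom t (((a : ℕ) : ℤ) - (b : ℕ)) : ℤ) : k))
        (fun a b => t + b - a) (fun _ _ h => binom_sub_weight h) v) := by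
  apply Subtype.ext
  rw [coe_extEquiv]
  have h1 : (extMap 𝓑 ℓ d t i (extEquiv 𝓑 d i v) : TruncExt k B d) =
      (extForm 𝓑 d ℓ : TruncExt k B d) ^ t * (extEquiv 𝓑 d i v : TruncExt k B d) := rfl
  rw [h1, coe_extEquiv, Finset.mul_sum]
  simp only [extForm_pow_mul, weightedMap_apply, TensorProduct.sum_tmul]
  rw [Finset.sum_comm]

end ExtMap

/-! ### Pairing source blocks with target blocks. -/

theorem pairRow_lt {d t a : ℕ} (ha : a < d) : pairRow d t a < d := by
  unfold pairRow
  split_ifs <;> omega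

theorem pairRow_le {d t a : ℕ} (ha : a < d) : pairRow d t a ≤ t + a := by
  unfold pairRow
  split_ifs <;> omega

/-- `pairRow` as a permutation of the indices. -/
noncomputable def pairEquiv (d t : ℕ) : Fin d ≃ Fin d :=
  Equiv.ofBijective (fun a => ⟨pairRow d t a, pairRow_lt a.2⟩) (by
    rw [← Finite.injective_iff_bijective]
    intro a b h
    have h1 : pairRow d t a = pairRow d t b := congrArg Fin.val h
    have := a.2
    have := b.2
    unfold pairRow at h1
    apply Fin.ext
    split_ifs at h1 <;> omega)

theorem coe_pairEquiv (d t : ℕ) (a : Fin d) : (pairEquiv d t a : ℕ) = pairRow d t a :=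
  rfl

/-- An array of scalars whose nonzero entries are compatible with the degrees of the blocks of
`ℓ ^ t`, and whose rows of index less than `N` are lower triangular with nonzero diagonal. -/
structure IsEchelon {k : Type*} [Field k] (d t N : ℕ) (c : ℕ → ℕ → k) : Prop where
  lower : ∀ a q, a < q → a < N → c a q = 0
  diag : ∀ a, a < N → c a a ≠ 0
  weight : ∀ a q, c a q ≠ 0 → pairRow d t a ≤ t + q

theorem pairedBinom_weight {k : Type*} [Field k] {d t a b : ℕ}
    (h : ((pairedBinom d t a b : ℤ) : k) ≠ 0) : pairRow d t a ≤ t + b := by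
  rw [pairedBinom, binom_natCast_sub] at h
  split_ifs at h with h1
  · by_contra hcon
    rw [Nat.choose_eq_zero_of_lt (by omega)] at h
    simp at h
  · simp at h

theorem colProd_weight {k : Type*} [Field k] {d t a q : ℕ} {U : ℕ → ℕ → k}
    (h : colProd (fun a b => ((pairedBinom d t a b : ℤ) : k)) U a q ≠ 0) :
    pairRow d t a ≤ t + q := by
  obtain ⟨b, hb, h1⟩ := Finset.exists_ne_zero_of_sum_ne_zero h
  have h2 := pairedBinom_weight (left_ne_zero_of_mul h1)
  have := Finset.mem_range.1 hb
  omega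

theorem weight_degree {d t a q : ℕ} (i : ℕ) (h : pairRow d t a ≤ t + q) :
    (i : ℤ) - (q : ℕ) + ((t + q - pairRow d t a : ℕ) : ℤ) = (i : ℤ) + t - (pairRow d t a : ℕ) := by
  omega

theorem Submodule.coe_eq_zero_of_eq_bot {R M : Type*} [Semiring R] [AddCommMonoid M] [Module R M]
    {p : Submodule R M} (h : p = ⊥) (x : p) : (x : M) = 0 :=
  (Submodule.mem_bot R).1 (h ▸ x.2)

/-- The indices of the blocks which are paired by the identity or belong to `qRange`. -/
def IsPaired (d t i s q : ℕ) : Prop := q + t < d ∨ (q + i + t ≤ d - 1 + s ∧ q ≤ i)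

/-- The unpaired blocks vanish in the source, or they vanish in the target. -/
theorem IsSocleDegree.eq_bot_or_eq_bot {k B : Type*} [Field k] [CommRing B] [Algebra k B]
    (𝓑 : ℕ → Submodule k B) (d t i : ℕ) {s : ℕ} (hs : IsSocleDegree 𝓑 s) :
    (∀ q : Fin d, ¬ IsPaired d t i s q → gr 𝓑 ((i : ℤ) - (q : ℕ)) = ⊥) ∨
      (∀ q : Fin d, ¬ IsPaired d t i s q →
        gr 𝓑 ((i : ℤ) + (t : ℤ) - (pairEquiv d t q : ℕ)) = ⊥) := by
  unfold IsPaired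
  by_cases h : i + (i + t) ≤ d - 1 + s
  · left
    intro q hq
    exact gr_eq_bot_of_neg 𝓑 (by omega)
  · right
    intro q hq
    apply hs.gr_eq_bot
    have := q.2
    rw [coe_pairEquiv, pairRow, if_neg (by omega)]
    omega

/-- The power in row `a` is a multiple of the diagonal power of column `q`: if `q + t < d` the
diagonal exponent is zero, and from `d - t` on `pairRow` decreases, so exponents grow down the
column. -/
theorem IsEchelon.smul_eq_zero {k B : Type*} [Field k] [CommRing B] [Algebra k B] {d t N : ℕ}
    {c : ℕ → ℕ → k} (hE : IsEchelon d t N c) {a q : Fin d} (hqa : q ≤ a) {x v : B}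
    (hv : x ^ (t + q - pairRow d t q) * v = 0) :
    c a q • (x ^ (t + q - pairRow d t a) * v) = 0 := by
  by_cases h : c a q = 0
  · rw [h, zero_smul]
  · have h1 := hE.weight a q h
    have h2 : (q : ℕ) ≤ a := hqa
    have := a.2
    have h3 : t + q - pairRow d t a =
        (t + q - pairRow d t a - (t + q - pairRow d t q)) + (t + q - pairRow d t q) := by
      unfold pairRow at h1 ⊢
      split_ifs at h1 ⊢ <;> omega
    rw [h3, pow_add, mul_assoc, hv, mul_zero, _root_.smul_zero]

/-! ### Reducing `ℓ^t` to lower triangular form. -/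

section Paired

variable {k B : Type*} [Field k] [CommRing B] [Algebra k B]
  (𝓑 : ℕ → Submodule k B) [GradedAlgebra 𝓑] (ℓ : 𝓑 1) (d t i : ℕ)

/-- The map `⨁ B_{i - q} → ⨁ B_{i + t - pairRow a}` with coefficients `c a q`. -/
noncomputable def pairedMap (c : ℕ → ℕ → k) (hc : ∀ a q, c a q ≠ 0 → pairRow d t a ≤ t + q) :
    (∀ q : Fin d, gr 𝓑 ((i : ℤ) - (q : ℕ))) →ₗ[k]
      ∀ a : Fin d, gr 𝓑 ((i : ℤ) + (t : ℤ) - (pairEquiv d t a : ℕ)) :=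
  weightedMap 𝓑 ℓ (fun q : Fin d => (i : ℤ) - (q : ℕ))
    (fun a : Fin d => (i : ℤ) + (t : ℤ) - (pairEquiv d t a : ℕ)) (fun a q => c a q)
    (fun a q => t + q - pairRow d t a) fun a q h => weight_degree i (hc a q h)

variable {d t} in
theorem pairedMap_apply (c : ℕ → ℕ → k) (hc : ∀ a q, c a q ≠ 0 → pairRow d t a ≤ t + q)
    (v : ∀ q : Fin d, gr 𝓑 ((i : ℤ) - (q : ℕ))) (a : Fin d) :
    (pairedMap 𝓑 ℓ d t i c hc v a : B) =
      ∑ q : Fin d, c a q • ((ℓ : B) ^ (t + q - pairRow d t a) * v q) :=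
  rfl

variable {d t} in
theorem pairedMap_single (c : ℕ → ℕ → k) (hc : ∀ a q, c a q ≠ 0 → pairRow d t a ≤ t + q)
    (q : Fin d) (v : gr 𝓑 ((i : ℤ) - (q : ℕ))) (a : Fin d) :
    (pairedMap 𝓑 ℓ d t i c hc (Pi.single q v) a : B) =
      c a q • ((ℓ : B) ^ (t + q - pairRow d t a) * v) :=
  weightedMap_single 𝓑 ℓ (fun q : Fin d => (i : ℤ) - (q : ℕ))
    (fun a : Fin d => (i : ℤ) + (t : ℤ) - (pairEquiv d t a : ℕ)) (fun a q => c a q)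
    (fun a q => t + q - pairRow d t a) _ q v a

/-- Permutation of the blocks of the target by `pairRow`. -/
noncomputable def targetEquiv :
    (∀ m : Fin d, gr 𝓑 ((i : ℤ) + (t : ℤ) - (m : ℕ))) ≃ₗ[k]
      ∀ a : Fin d, gr 𝓑 ((i : ℤ) + (t : ℤ) - (pairEquiv d t a : ℕ)) :=
  LinearEquiv.piCongrLeft' k (fun m : Fin d => gr 𝓑 ((i : ℤ) + (t : ℤ) - (m : ℕ)))
    (pairEquiv d t).symm

theorem extMap_eq_pairedMap (v : ∀ m : Fin d, gr 𝓑 ((i : ℤ) - (m : ℕ))) :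
    extMap 𝓑 ℓ d t i (extEquiv 𝓑 d i v) =
      extEquiv 𝓑 d ((i : ℤ) + t) ((targetEquiv 𝓑 d t i).symm
        (pairedMap 𝓑 ℓ d t i (fun a b => ((pairedBinom d t a b : ℤ) : k))
          (fun _ _ h => pairedBinom_weight h) v)) := by
  rw [extMap_extEquiv]
  congr 1
  rw [LinearEquiv.eq_symm_apply]
  rfl

/-- The automorphism of `⨁ B_{i - q}` given by an upper unitriangular matrix. -/
noncomputable def colMap (U : ℕ → ℕ → k) (hU : ∀ b q, q < b → U b q = 0) :
    (∀ q : Fin d, gr 𝓑 ((i : ℤ) - (q : ℕ))) →ₗ[k] ∀ q : Fin d, gr 𝓑 ((i : ℤ) - (q : ℕ)) :=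
  weightedMap 𝓑 ℓ (fun q : Fin d => (i : ℤ) - (q : ℕ)) (fun q : Fin d => (i : ℤ) - (q : ℕ))
    (fun b q => U b q) (fun b q => q - b) fun b q h => by
      have : ¬ (q : ℕ) < b := fun h1 => h (hU b q h1)
      omega

theorem pairedMap_comp_colMap {N : ℕ} {U : ℕ → ℕ → k}
    (hU : IsColReduction (fun a b => ((pairedBinom d t a b : ℤ) : k)) U N) :
    pairedMap 𝓑 ℓ d t i (fun a b => ((pairedBinom d t a b : ℤ) : k))
        (fun _ _ h => pairedBinom_weight h) ∘ₗ colMap 𝓑 ℓ d i U hU.upper =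
      pairedMap 𝓑 ℓ d t i (colProd (fun a b => ((pairedBinom d t a b : ℤ) : k)) U)
        (fun _ _ h => colProd_weight h) := by
  apply weightedMap_comp
  · intro a q
    rw [colProd, Finset.sum_subset (Finset.range_mono (Nat.succ_le_of_lt q.2)),
      Finset.sum_range]
    intro b _ hb
    rw [hU.upper b q (by simpa using hb), mul_zero]
  · intro a b q h1 h2
    have h3 := pairedBinom_weight h1
    have h4 : ¬ (q : ℕ) < b := fun h => h2 (hU.upper b q h)
    omega

theorem colMap_bijective [Module.Finite k B] {N : ℕ} {H U : ℕ → ℕ → k}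
    (hU : IsColReduction H U N) : Function.Bijective (colMap 𝓑 ℓ d i U hU.upper) :=
  weightedMap_bijective 𝓑 ℓ _ _ _ _ (fun a => hU.diag a) fun a b h => hU.upper a b h

theorem extMap_injective_iff [Module.Finite k B] {N : ℕ} {U : ℕ → ℕ → k}
    (hU : IsColReduction (fun a b => ((pairedBinom d t a b : ℤ) : k)) U N) :
    Function.Injective (extMap 𝓑 ℓ d t i) ↔ Function.Injective
      (pairedMap 𝓑 ℓ d t i (colProd (fun a b => ((pairedBinom d t a b : ℤ) : k)) U)
        (fun _ _ h => colProd_weight h)) := by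
  rw [← pairedMap_comp_colMap 𝓑 ℓ d t i hU, LinearMap.coe_comp,
    Function.Injective.of_comp_iff' _ (colMap_bijective 𝓑 ℓ d i hU),
    ← (extEquiv 𝓑 d i).bijective |> Function.Injective.of_comp_iff' _]
  have h : extMap 𝓑 ℓ d t i ∘ extEquiv 𝓑 d i =
      (extEquiv 𝓑 d ((i : ℤ) + t) ∘ (targetEquiv 𝓑 d t i).symm) ∘ _ :=
    funext fun v => extMap_eq_pairedMap 𝓑 ℓ d t i v
  rw [h, Function.Injective.of_comp_iff]
  exact (extEquiv 𝓑 d ((i : ℤ) + t)).injective.comp (targetEquiv 𝓑 d t i).symm.injective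

theorem extMap_surjective_iff [Module.Finite k B] {N : ℕ} {U : ℕ → ℕ → k}
    (hU : IsColReduction (fun a b => ((pairedBinom d t a b : ℤ) : k)) U N) :
    Function.Surjective (extMap 𝓑 ℓ d t i) ↔ Function.Surjective
      (pairedMap 𝓑 ℓ d t i (colProd (fun a b => ((pairedBinom d t a b : ℤ) : k)) U)
        (fun _ _ h => colProd_weight h)) := by
  rw [← pairedMap_comp_colMap 𝓑 ℓ d t i hU, LinearMap.coe_comp,
    Function.Surjective.of_comp_iff _ (colMap_bijective 𝓑 ℓ d i hU).surjective,
    ← Function.Surjective.of_comp_iff _ (extEquiv 𝓑 d i).surjective]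
  have h : extMap 𝓑 ℓ d t i ∘ extEquiv 𝓑 d i =
      (extEquiv 𝓑 d ((i : ℤ) + t) ∘ (targetEquiv 𝓑 d t i).symm) ∘ _ :=
    funext fun v => extMap_eq_pairedMap 𝓑 ℓ d t i v
  rw [h, Function.Surjective.of_comp_iff']
  exact (extEquiv 𝓑 d ((i : ℤ) + t)).bijective.comp (targetEquiv 𝓑 d t i).symm.bijective

/-! ### Rank of a triangular block map through its diagonal blocks. -/

variable {𝓑 ℓ d t i} {N : ℕ} {c : ℕ → ℕ → k} (hE : IsEchelon d t N c)
include hE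

/-- Forward substitution: once the diagonal powers kill the earlier coordinates, their contributions
to row `a` vanish and only the diagonal term is left. -/
theorem IsEchelon.pow_mul_eq_zero (v : ∀ q : Fin d, gr 𝓑 ((i : ℤ) - (q : ℕ))) (n : ℕ) (hn : n ≤ N)
    (hv : ∀ a : Fin d, (a : ℕ) < n → (pairedMap 𝓑 ℓ d t i c hE.weight v a : B) = 0) (a : Fin d)
    (ha : (a : ℕ) < n) : (ℓ : B) ^ (t + a - pairRow d t a) * (v a : B) = 0 := by
  induction a using WellFoundedLT.induction with
  | ind a ih =>
    have h1 := hv a ha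
    rw [pairedMap_apply, Finset.sum_eq_single a] at h1
    · exact (_root_.smul_eq_zero.1 h1).resolve_left (hE.diag a (by omega))
    · intro q _ hq
      rcases lt_or_gt_of_ne hq with h2 | h2
      · exact hE.smul_eq_zero h2.le (ih q h2 (by have : (q : ℕ) < a := h2; omega))
      · rw [hE.lower a q h2 (by omega), zero_smul]
    · simp

variable {s : ℕ}

theorem IsEchelon.injective_of_forall (hs : IsSocleDegree 𝓑 s)
    (hN : ∀ q : Fin d, IsPaired d t i s q → (q : ℕ) < N)
    (h : ∀ q : Fin d, d ≤ q + t → ∀ v ∈ gr 𝓑 ((i : ℤ) - (q : ℕ)),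
      (ℓ : B) ^ (t + q - pairRow d t q) * v = 0 → v = 0) :
    Function.Injective (pairedMap 𝓑 ℓ d t i c hE.weight) := by
  rw [← LinearMap.ker_eq_bot, LinearMap.ker_eq_bot']
  intro v hv
  funext q
  apply Subtype.ext
  by_cases hq : IsPaired d t i s q
  · have h1 := hE.pow_mul_eq_zero v N le_rfl (fun a _ => by rw [hv]; rfl) q (hN q hq)
    by_cases h2 : q + t < d
    · rw [pairRow, if_pos h2, show t + (q : ℕ) - (q + t) = 0 by omega, pow_zero, one_mul] at h1
      exact h1
    · exact h q (by omega) _ (v q).2 h1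
  · rcases hs.eq_bot_or_eq_bot 𝓑 d t i with h1 | h1
    · exact (Submodule.mem_bot k).1 (h1 q hq ▸ (v q).2)
    · refine h q (by unfold IsPaired at hq; omega) _ (v q).2 ?_
      rw [← Submodule.mem_bot k, ← h1 q hq, coe_pairEquiv, ← weight_degree i (pairRow_le q.2),
        add_comm]
      exact mul_mem_gr 𝓑 (pow_mem_gr 𝓑 ℓ _) (v q).2

theorem IsEchelon.surjective_of_forall (hs : IsSocleDegree 𝓑 s)
    (hN : ∀ q : Fin d, IsPaired d t i s q → (q : ℕ) < N)
    (h : ∀ q : Fin d, d ≤ q + t → ∀ w ∈ gr 𝓑 ((i : ℤ) + (t : ℤ) - (pairEquiv d t q : ℕ)),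
      ∃ v ∈ gr 𝓑 ((i : ℤ) - (q : ℕ)), (ℓ : B) ^ (t + q - pairRow d t q) * v = w) :
    Function.Surjective (pairedMap 𝓑 ℓ d t i c hE.weight) := by
  intro w
  -- The rows are solved one at a time. Correcting coordinate `n` does not disturb earlier rows, by
  -- triangularity.
  have key : ∀ n : ℕ, ∃ v : ∀ q : Fin d, gr 𝓑 ((i : ℤ) - (q : ℕ)), ∀ a : Fin d, (a : ℕ) < n →
      (pairedMap 𝓑 ℓ d t i c hE.weight v a : B) = w a := by
    intro n
    induction n with
    | zero => exact ⟨0, fun a ha => by omega⟩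
    | succ n ih =>
      obtain ⟨v, hv⟩ := ih
      by_cases hn : n < d
      · set a : Fin d := ⟨n, hn⟩ with ha
        by_cases hp : IsPaired d t i s n
        · have hnN := hN a hp
          have h1 : ∃ u ∈ gr 𝓑 ((i : ℤ) - (a : ℕ)), (ℓ : B) ^ (t + a - pairRow d t a) * u =
              (w a - pairedMap 𝓑 ℓ d t i c hE.weight v a :
                gr 𝓑 ((i : ℤ) + (t : ℤ) - (pairEquiv d t a : ℕ))) := by
            by_cases h2 : (a : ℕ) + t < d
            · refine ⟨(w a - pairedMap 𝓑 ℓ d t i c hE.weight v a :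
                gr 𝓑 ((i : ℤ) + (t : ℤ) - (pairEquiv d t a : ℕ))), ?_, ?_⟩
              rotate_left
              · rw [pairRow, if_pos h2, show t + (a : ℕ) - (a + t) = 0 by omega, pow_zero, one_mul]
              · have h3 := weight_degree i (pairRow_le (t := t) a.2)
                rw [pairRow, if_pos h2, show t + (a : ℕ) - (a + t) = 0 by omega, Nat.cast_zero,
                  add_zero] at h3
                have h4 : gr 𝓑 ((i : ℤ) + (t : ℤ) - (pairEquiv d t a : ℕ)) =
                    gr 𝓑 ((i : ℤ) - (a : ℕ)) := by
                  rw [h3, coe_pairEquiv, pairRow, if_pos h2]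
                exact h4 ▸ Subtype.mem _
            · exact h a (by omega) _ (Subtype.mem _)
          obtain ⟨u, hu, hu'⟩ := h1
          refine ⟨v + Pi.single a ((c n n)⁻¹ • ⟨u, hu⟩), fun b hb => ?_⟩
          rw [map_add, Pi.add_apply, Submodule.coe_add, pairedMap_single]
          by_cases hba : b = a
          · have h4 : c b a = c n n := by rw [hba]
            rw [h4, hba]
            simp only [Submodule.coe_smul, mul_smul_comm, smul_smul]
            rw [mul_inv_cancel₀ (hE.diag n hnN), one_smul, hu']
            simp
          · have h5 : (b : ℕ) < n := by
              have : (b : ℕ) ≠ n := fun h => hba (Fin.ext h)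
              omega
            rw [hE.lower b a h5 (by have : n < N := hnN; omega), zero_smul, add_zero, hv b h5]
        · rcases hs.eq_bot_or_eq_bot 𝓑 d t i with h1 | h1
          · have hbot : gr 𝓑 ((i : ℤ) + (t : ℤ) - (pairEquiv d t a : ℕ)) = ⊥ := by
              rw [eq_bot_iff]
              intro x hx
              obtain ⟨u, hu, rfl⟩ := h a (by unfold IsPaired at hp; simp only [ha]; omega) x hx
              rw [h1 a hp, Submodule.mem_bot] at hu
              rw [hu, mul_zero]
              exact Submodule.zero_mem _
            refine ⟨v, fun b hb => ?_⟩
            by_cases hba : b = a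
            · rw [← hba] at hbot
              rw [Submodule.coe_eq_zero_of_eq_bot hbot (w b),
                Submodule.coe_eq_zero_of_eq_bot hbot (pairedMap 𝓑 ℓ d t i c hE.weight v b)]
            · exact hv b (by have : (b : ℕ) ≠ n := fun h => hba (Fin.ext h); omega)
          · have hbot := h1 a hp
            refine ⟨v, fun b hb => ?_⟩
            by_cases hba : b = a
            · rw [← hba] at hbot
              rw [Submodule.coe_eq_zero_of_eq_bot hbot (w b),
                Submodule.coe_eq_zero_of_eq_bot hbot (pairedMap 𝓑 ℓ d t i c hE.weight v b)]
            · exact hv b (by have : (b : ℕ) ≠ n := fun h => hba (Fin.ext h); omega)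
      · exact ⟨v, fun b hb => hv b (by omega)⟩
  obtain ⟨v, hv⟩ := key d
  exact ⟨v, funext fun a => Subtype.ext (hv a a.2)⟩

/-- A vector of a paired block killed by the diagonal power is killed by its whole column, even if
the pivot is zero. The unpaired blocks matter only when their targets vanish. -/
theorem IsEchelon.forall_of_injective (hB : IsStandardGradedArtinian 𝓑) (hs : IsSocleDegree 𝓑 s)
    (hN : ∀ q : Fin d, IsPaired d t i s q →
      (q : ℕ) < N ∨ (q : ℕ) = N ∧ c q q = 0 ∧ d ≤ q + t)
    (hinj : Function.Injective (pairedMap 𝓑 ℓ d t i c hE.weight)) (q : Fin d) (v : B)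
    (hv : v ∈ gr 𝓑 ((i : ℤ) - (q : ℕ))) (hv0 : (ℓ : B) ^ (t + q - pairRow d t q) * v = 0) :
    v = 0 := by
  have hsingle : ∀ (q : Fin d) (v : gr 𝓑 ((i : ℤ) - (q : ℕ))),
      (∀ a : Fin d, c a q • ((ℓ : B) ^ (t + q - pairRow d t a) * (v : B)) = 0) → (v : B) = 0 := by
    intro q v h
    have h1 : pairedMap 𝓑 ℓ d t i c hE.weight (Pi.single q v) = 0 := by
      funext a
      apply Subtype.ext
      rw [pairedMap_single, h a]
      rfl
    have h2 := congrFun (hinj (h1.trans (map_zero _).symm)) q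
    rw [Pi.single_eq_same] at h2
    rw [h2]
    rfl
  by_cases hq : IsPaired d t i s q
  · refine hsingle q ⟨v, hv⟩ fun a => ?_
    by_cases hqa : q ≤ a
    · exact hE.smul_eq_zero hqa hv0
    · push Not at hqa
      rw [hE.lower a q hqa (by have := hN q hq; have : (a : ℕ) < q := hqa; omega), zero_smul]
  rcases hs.eq_bot_or_eq_bot 𝓑 d t i with h1 | h1
  · exact (Submodule.mem_bot k).1 (h1 q hq ▸ hv)
  have hbad : ∀ (q : Fin d) (v : gr 𝓑 ((i : ℤ) - (q : ℕ))) (a : Fin d), ¬ IsPaired d t i s a →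
      c a q • ((ℓ : B) ^ (t + q - pairRow d t a) * (v : B)) = 0 := by
    intro q v a ha
    rw [← pairedMap_single 𝓑 ℓ i c hE.weight]
    exact (Submodule.mem_bot k).1 (h1 a ha ▸ Subtype.mem _)
  -- If the last pivot is zero, its whole column is zero, since the rows after it have zero target.
  -- Its source block is nonzero, against injectivity.
  by_cases hex : ∃ a : Fin d, IsPaired d t i s a ∧ (a : ℕ) = N ∧ c a a = 0 ∧ d ≤ a + t
  · obtain ⟨a, ha, haN, hca, hda⟩ := hex
    exfalso
    have hne : gr 𝓑 ((i : ℤ) - (a : ℕ)) ≠ ⊥ := by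
      unfold IsPaired at ha
      exact hB.gr_ne_bot hs (by omega) (by omega)
    apply hne
    rw [eq_bot_iff]
    intro u hu
    refine hsingle a ⟨u, hu⟩ fun b => ?_
    by_cases hb : IsPaired d t i s b
    · rcases hN b hb with h2 | h2
      · rw [hE.lower b a (by omega) h2, zero_smul]
      · obtain rfl : b = a := Fin.ext (by omega)
        rw [hca, zero_smul]
    · exact hbad a _ b hb
  -- Otherwise an unpaired column lies to the right of all paired rows, so it is zero and its source
  -- block must be zero.
  · refine hsingle q ⟨v, hv⟩ fun a => ?_
    by_cases ha : IsPaired d t i s a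
    · have haN : (a : ℕ) < N := (hN a ha).resolve_right fun h => hex ⟨a, ha, h⟩
      rw [hE.lower a q (by unfold IsPaired at ha hq; omega) haN, zero_smul]
    · exact hbad q ⟨v, hv⟩ a ha

/-- The counterpart for rows: in a preimage of a vector supported in block `q`, the earlier columns
contribute nothing to row `q`, and the terms from column `q` on all have the diagonal power as a
factor. -/
theorem IsEchelon.forall_of_surjective (hB : IsStandardGradedArtinian 𝓑) (hs : IsSocleDegree 𝓑 s)
    (hN : ∀ q : Fin d, IsPaired d t i s q →
      (q : ℕ) < N ∨ (q : ℕ) = N ∧ c q q = 0 ∧ d ≤ q + t)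
    (hsurj : Function.Surjective (pairedMap 𝓑 ℓ d t i c hE.weight)) (q : Fin d) (w : B)
    (hw : w ∈ gr 𝓑 ((i : ℤ) + (t : ℤ) - (pairEquiv d t q : ℕ))) :
    ∃ v ∈ gr 𝓑 ((i : ℤ) - (q : ℕ)), (ℓ : B) ^ (t + q - pairRow d t q) * v = w := by
  have hsingle : ∀ (q : Fin d) (w : gr 𝓑 ((i : ℤ) + (t : ℤ) - (pairEquiv d t q : ℕ))),
      ∃ v : ∀ q : Fin d, gr 𝓑 ((i : ℤ) - (q : ℕ)),
        ∑ b : Fin d, c q b • ((ℓ : B) ^ (t + b - pairRow d t q) * (v b : B)) = w ∧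
        ∀ b < q, (b : ℕ) < N →
          c q b • ((ℓ : B) ^ (t + b - pairRow d t q) * (v b : B)) = 0 := by
    intro q w
    obtain ⟨v, hv⟩ := hsurj (Pi.single q w)
    refine ⟨v, ?_, fun b hb hbN => ?_⟩
    · rw [← pairedMap_apply 𝓑 ℓ i c hE.weight, hv, Pi.single_eq_same]
    · refine hE.smul_eq_zero hb.le (hE.pow_mul_eq_zero v (min q N) (min_le_right _ _) ?_ b
        (lt_min hb hbN))
      intro a ha
      rw [hv, Pi.single_eq_of_ne (fun h => by rw [h] at ha; omega)]
      rfl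
  by_cases hq : IsPaired d t i s q
  · obtain ⟨v, hv, hv'⟩ := hsingle q ⟨w, hw⟩
    -- Row `q` from the diagonal on, with the diagonal power divided out of every term.
    refine ⟨∑ b : Fin d, if q ≤ b then c q b • ((ℓ : B) ^ ((b : ℕ) - q) * (v b : B)) else 0,
      Submodule.sum_mem _ fun b _ => ?_, ?_⟩
    · split_ifs with h
      · have h1 := mul_mem_gr 𝓑 (pow_mem_gr 𝓑 ℓ ((b : ℕ) - q)) (v b).2
        rw [show (((b : ℕ) - q : ℕ) : ℤ) + ((i : ℤ) - (b : ℕ)) = (i : ℤ) - (q : ℕ) by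
          have : (q : ℕ) ≤ b := h
          omega] at h1
        exact Submodule.smul_mem _ _ h1
      · exact Submodule.zero_mem _
    · have h2 : w = ((⟨w, hw⟩ : gr 𝓑 ((i : ℤ) + (t : ℤ) - (pairEquiv d t q : ℕ))) : B) := rfl
      rw [h2, ← hv, Finset.mul_sum]
      refine Finset.sum_congr rfl fun b _ => ?_
      split_ifs with h
      · have h3 := pairRow_le (t := t) q.2
        rw [mul_smul_comm, ← mul_assoc, ← pow_add,
          show t + (q : ℕ) - pairRow d t q + (b - q) = t + b - pairRow d t q by
            have : (q : ℕ) ≤ b := h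
            omega]
      · push Not at h
        rw [mul_zero, hv' b h (by have := hN q hq; have : (b : ℕ) < q := h; omega)]
  rcases hs.eq_bot_or_eq_bot 𝓑 d t i with h1 | h1
  · have hbad : ∀ (v : ∀ q : Fin d, gr 𝓑 ((i : ℤ) - (q : ℕ))) (q b : Fin d),
        ¬ IsPaired d t i s b → c q b • ((ℓ : B) ^ (t + b - pairRow d t q) * (v b : B)) = 0 := by
      intro v q b hb
      rw [(Submodule.mem_bot k).1 (h1 b hb ▸ (v b).2 : (v b : B) ∈ (⊥ : Submodule k B)), mul_zero,
        _root_.smul_zero]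
    -- With a zero last pivot, nothing reaches its nonzero target block: earlier columns contribute
    -- zero and later ones have zero source.
    by_cases hex : ∃ a : Fin d, IsPaired d t i s a ∧ (a : ℕ) = N ∧ c a a = 0 ∧ d ≤ a + t
    · obtain ⟨a, ha, haN, hca, hda⟩ := hex
      exfalso
      have hne : gr 𝓑 ((i : ℤ) + (t : ℤ) - (pairEquiv d t a : ℕ)) ≠ ⊥ := by
        unfold IsPaired at ha
        have := a.2
        refine hB.gr_ne_bot hs ?_ ?_ <;> rw [coe_pairEquiv, pairRow, if_neg (by omega)] <;> omega
      apply hne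
      rw [eq_bot_iff]
      intro u hu
      obtain ⟨v, hv, hv'⟩ := hsingle a ⟨u, hu⟩
      rw [Submodule.mem_bot]
      refine hv.symm.trans (Finset.sum_eq_zero fun b _ => ?_)
      by_cases hb : IsPaired d t i s b
      · rcases hN b hb with h2 | h2
        · exact hv' b (show (b : ℕ) < a by omega) h2
        · obtain rfl : b = a := Fin.ext (by omega)
          rw [hca, zero_smul]
      · exact hbad v a b hb
    · refine ⟨0, Submodule.zero_mem _, ?_⟩
      obtain ⟨v, hv, hv'⟩ := hsingle q ⟨w, hw⟩
      rw [mul_zero]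
      refine (hv.symm.trans (Finset.sum_eq_zero fun b _ => ?_)).symm
      by_cases hb : IsPaired d t i s b
      · have hbN : (b : ℕ) < N := (hN b hb).resolve_right fun h => hex ⟨b, hb, h⟩
        exact hv' b (show (b : ℕ) < q by unfold IsPaired at hb hq; omega) hbN
      · exact hbad v q b hb
  · refine ⟨0, Submodule.zero_mem _, ?_⟩
    rw [mul_zero]
    exact ((Submodule.mem_bot k).1 (h1 q hq ▸ hw)).symm

end Paired

/-! ### Pivots under the characteristic conditions. -/

theorem CharCond.det_ne_zero {k : Type*} [Field k] {t d lo p : ℕ} (h : CharCond k t d lo)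
    (hlo : lo ≤ p) (hpd : p ≤ d - 1) (hpt : p ≤ t - 1) : (((matC t p d).det : ℤ) : k) ≠ 0 := by
  rcases h with h | h
  · have : CharZero k := (CharP.ringChar_zero_iff_CharZero k).1 h
    rw [Int.cast_ne_zero]
    exact det_matC_ne_zero t p d (by omega) (by omega)
  · intro h0
    apply h
    rw [CharP.intCast_eq_zero_iff k (ringChar k)] at h0
    exact h0.trans (Finset.dvd_prod_of_mem (fun p => (matC t p d).det)
      (Finset.mem_Icc.2 ⟨hlo, le_min hpd hpt⟩))

theorem leadMinor_pairedBinom_ne_zero (k : Type*) [Field k] (d t r : ℕ) (hr : r ≤ d)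
    (h : 1 ≤ d - r → d - r ≤ d - 1 → d - r ≤ t - 1 → (((matC t (d - r) d).det : ℤ) : k) ≠ 0) :
    leadMinor (fun a b => ((pairedBinom d t a b : ℤ) : k)) r ≠ 0 := by
  rw [leadMinor_intCast]
  by_cases h1 : r ≤ d - t
  · rw [leadMinor_pairedBinom_of_le d t r h1]
    simp
  · have h2 := leadMinor_pairedBinom_sq d t r (by omega) hr
    intro h0
    have h3 : (((matC t (d - r) d).det : ℤ) : k) = 0 := by
      rw [← pow_eq_zero_iff two_ne_zero, ← Int.cast_pow, ← h2, Int.cast_pow, h0]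
      simp
    by_cases h4 : r = d
    · subst h4
      have h5 := congrArg (Int.cast : ℤ → k) (det_matC_zero_sq t r)
      rw [Nat.sub_self] at h3
      rw [Int.cast_pow, h3] at h5
      simp at h5
    · exact h (by omega) (by omega) (by omega) h3

theorem exists_isEchelon {k : Type*} [Field k] {d t i s : ℕ}
    (h : CharCond k t d (max 1 (max (d - i) (i + t + 1 - s)))) :
    ∃ (N : ℕ) (U : ℕ → ℕ → k),
      IsColReduction (fun a b => ((pairedBinom d t a b : ℤ) : k)) U N ∧
      IsEchelon d t N (colProd (fun a b => ((pairedBinom d t a b : ℤ) : k)) U) ∧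
      ∀ q : Fin d, IsPaired d t i s q → (q : ℕ) < N ∨ (q : ℕ) = N ∧
        colProd (fun a b => ((pairedBinom d t a b : ℤ) : k)) U q q = 0 ∧ d ≤ q + t := by
  set H : ℕ → ℕ → k := fun a b => ((pairedBinom d t a b : ℤ) : k) with hH
  -- `N₀` bounds every paired index. With `p = d - r`, the lower limit of the product (1) says
  -- exactly that the orders `r` up to `min i (d - 1 + s - i - t)` are covered.
  set N₀ := max (d - t) (min (d - 1) (min i ((d - 1 + s) - (i + t)))) with hN₀
  have hne : ∀ r ≤ N₀, leadMinor H r ≠ 0 := by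
    intro r hr
    refine leadMinor_pairedBinom_ne_zero k d t r (by omega) fun h1 h2 h3 => ?_
    exact h.det_ne_zero (by omega) h2 h3
  have hech : ∀ N U, (∀ r ≤ N, leadMinor H r ≠ 0) → IsColReduction H U N →
      IsEchelon d t N (colProd H U) := by
    intro N U hN hU
    refine ⟨hU.lower, fun a ha => ?_, fun a q h => colProd_weight h⟩
    have h1 := hN (a + 1) ha
    rw [hU.leadMinor_succ a ha.le] at h1
    exact right_ne_zero_of_mul h1
  have hpaired : ∀ q : Fin d, IsPaired d t i s q → (q : ℕ) ≤ N₀ := by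
    intro q hq
    have := q.2
    unfold IsPaired at hq
    omega
  -- The minor of order `N₀ + 1` is beyond (1), and it decides whether the last pivot is zero.
  by_cases h1 : leadMinor H (N₀ + 1) = 0
  · obtain ⟨U, hU⟩ := exists_isColReduction H N₀ hne
    refine ⟨N₀, U, hU, hech _ _ hne hU, fun q hq => ?_⟩
    rcases (hpaired q hq).lt_or_eq with h2 | h2
    · exact Or.inl h2
    · refine Or.inr ⟨h2, ?_, ?_⟩
      · rw [hU.leadMinor_succ N₀ le_rfl] at h1
        rw [h2]
        exact (mul_eq_zero.1 h1).resolve_left (hne N₀ le_rfl)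
      · omega
  · have hne' : ∀ r ≤ N₀ + 1, leadMinor H r ≠ 0 := by
      intro r hr
      rcases hr.lt_or_eq with h2 | h2
      · exact hne r (by omega)
      · rwa [h2]
    obtain ⟨U, hU⟩ := exists_isColReduction H (N₀ + 1) hne'
    exact ⟨N₀ + 1, U, hU, hech _ _ hne' hU, fun q hq => Or.inl (by have := hpaired q hq; omega)⟩

theorem qExp_eq {d t q : ℕ} (hq : q < d) (h : d ≤ q + t) : t + q - pairRow d t q = qExp d t q := by
  rw [pairRow, if_neg (by omega), qExp]
  omega

theorem moduleFinite_gr_extGrading {k B : Type*} [Field k] [CommRing B] [Algebra k B]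
    (𝓑 : ℕ → Submodule k B) {d : ℕ} [Module.Finite k B] (j : ℤ) :
    Module.Finite k (gr (extGrading 𝓑 d) j) :=
  Module.Finite.equiv (extEquiv 𝓑 d j)

/-! ### The full rank criterion. -/

section Rank

variable {k B : Type*} [Field k] [CommRing B] [Algebra k B]
  (𝓑 : ℕ → Submodule k B) [GradedAlgebra 𝓑] (ℓ : 𝓑 1) (d t i : ℕ)

theorem recMap_target (q : Fin d) (h : d ≤ q + t) :
    (i : ℤ) - ((q : ℕ) : ℤ) + (qExp d t q : ℤ) = (i : ℤ) + (t : ℤ) - (pairEquiv d t q : ℕ) := by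
  rw [← qExp_eq q.2 h]
  exact weight_degree i (pairRow_le q.2)

theorem coe_recMap (q : ℕ) (v : gr 𝓑 ((i : ℤ) - (q : ℤ))) :
    (recMap 𝓑 ℓ d t i q v : B) = (ℓ : B) ^ qExp d t q * v :=
  rfl

variable {d t i}

theorem recMap_injective_iff (q : Fin d) (h : d ≤ q + t) :
    Function.Injective (recMap 𝓑 ℓ d t i q) ↔ ∀ v ∈ gr 𝓑 ((i : ℤ) - (q : ℕ)),
      (ℓ : B) ^ (t + q - pairRow d t q) * v = 0 → v = 0 := by
  rw [← LinearMap.ker_eq_bot, LinearMap.ker_eq_bot', qExp_eq q.2 h]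
  constructor
  · intro h1 v hv hv0
    exact congrArg Subtype.val (h1 ⟨v, hv⟩ (Subtype.ext hv0))
  · intro h1 v hv
    exact Subtype.ext (h1 v v.2 (congrArg Subtype.val hv))

theorem recMap_surjective_iff (q : Fin d) (h : d ≤ q + t) :
    Function.Surjective (recMap 𝓑 ℓ d t i q) ↔
      ∀ w ∈ gr 𝓑 ((i : ℤ) + (t : ℤ) - (pairEquiv d t q : ℕ)),
        ∃ v ∈ gr 𝓑 ((i : ℤ) - (q : ℕ)), (ℓ : B) ^ (t + q - pairRow d t q) * v = w := by
  rw [qExp_eq q.2 h, ← recMap_target d t i q h]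
  constructor
  · intro h1 w hw
    obtain ⟨v, hv⟩ := h1 ⟨w, hw⟩
    exact ⟨v, v.2, congrArg Subtype.val hv⟩
  · intro h1 w
    obtain ⟨v, hv, hvw⟩ := h1 w w.2
    exact ⟨⟨v, hv⟩, Subtype.ext hvw⟩

theorem forall_Icc_iff (hd : 1 ≤ d) (P : ℕ → Prop) :
    (∀ q : Finset.Icc (d - t) (d - 1), P q) ↔ ∀ q : Fin d, d ≤ q + t → P q := by
  constructor
  · intro h q hq
    exact h ⟨q, Finset.mem_Icc.2 ⟨by omega, by omega⟩⟩
  · intro h q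
    have := Finset.mem_Icc.1 q.2
    exact h ⟨q, by omega⟩ (by simp only []; omega)

theorem fullRankForSameReason_of_hasFullRank (hB : IsStandardGradedArtinian 𝓑) {s : ℕ}
    (hs : IsSocleDegree 𝓑 s) (hd : 1 ≤ d)
    (h : CharCond k t d (max 1 (max (d - i) (i + t + 1 - s))))
    (hM : HasFullRank (extMap 𝓑 ℓ d t i)) :
    FullRankForSameReason (fun q : Finset.Icc (d - t) (d - 1) => recMap 𝓑 ℓ d t i q) := by
  have := hB.finite
  have := moduleFinite_gr_extGrading 𝓑 (d := d) (i : ℤ)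
  have := moduleFinite_gr_extGrading 𝓑 (d := d) ((i : ℤ) + t)
  obtain ⟨N, U, hU, hE, hN⟩ := exists_isEchelon h
  rw [hasFullRank_iff, extMap_injective_iff 𝓑 ℓ d t i hU, extMap_surjective_iff 𝓑 ℓ d t i hU] at hM
  refine hM.imp (fun hM => ?_) fun hM => ?_
  · refine (forall_Icc_iff hd fun q => Function.Injective (recMap 𝓑 ℓ d t i q)).2 fun q hq => ?_
    exact (recMap_injective_iff 𝓑 ℓ q hq).2 (hE.forall_of_injective hB hs hN hM q)
  · refine (forall_Icc_iff hd fun q => Function.Surjective (recMap 𝓑 ℓ d t i q)).2 fun q hq => ?_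
    exact (recMap_surjective_iff 𝓑 ℓ q hq).2 (hE.forall_of_surjective hB hs hN hM q)

theorem hasFullRank_of_fullRankForSameReason (hB : IsStandardGradedArtinian 𝓑) {s : ℕ}
    (hs : IsSocleDegree 𝓑 s) (hd : 1 ≤ d)
    (h : CharCond k t d (max 1 (max (d - i) (i + t + 1 - s))))
    (h' : CharCond k t d (max 1 (max (d - 1 - i) (i + t - s))))
    (hq : FullRankForSameReason (fun q : Finset.Icc (d - t) (d - 1) => recMap 𝓑 ℓ d t i q)) :
    HasFullRank (extMap 𝓑 ℓ d t i) := by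
  have := hB.finite
  have := moduleFinite_gr_extGrading 𝓑 (d := d) (i : ℤ)
  have := moduleFinite_gr_extGrading 𝓑 (d := d) ((i : ℤ) + t)
  obtain ⟨N, U, hU, hE, hN⟩ := exists_isEchelon h
  rw [hasFullRank_iff, extMap_injective_iff 𝓑 ℓ d t i hU, extMap_surjective_iff 𝓑 ℓ d t i hU]
  have hN' : ∀ q : Fin d, IsPaired d t i s q → (q : ℕ) < N := by
    intro q hqp
    rcases hN q hqp with h1 | ⟨h1, h2, h3⟩
    · exact h1
    · exfalso
      -- Condition (2) reaches one order further than (1) and so excludes a zero last pivot.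
      refine leadMinor_pairedBinom_ne_zero k d t (q + 1) q.2 (fun h4 h5 h6 => ?_) ?_
      · unfold IsPaired at hqp
        exact h'.det_ne_zero (by omega) h5 h6
      · rw [hU.leadMinor_succ q h1.le, h2, mul_zero]
  refine hq.imp (fun hq => ?_) fun hq => ?_
  · refine hE.injective_of_forall hs hN' fun q hqt => ?_
    exact (recMap_injective_iff 𝓑 ℓ q hqt).1
      ((forall_Icc_iff hd fun q => Function.Injective (recMap 𝓑 ℓ d t i q)).1 hq q hqt)
  · refine hE.surjective_of_forall hs hN' fun q hqt => ?_
    exact (recMap_surjective_iff 𝓑 ℓ q hqt).1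
      ((forall_Icc_iff hd fun q => Function.Surjective (recMap 𝓑 ℓ d t i q)).1 hq q hqt)

end Rank

/-! ### Determinants of block matrices up to sign. -/

theorem Matrix.det_submatrix_sq {R κ μ : Type*} [CommRing R] [Fintype κ] [DecidableEq κ]
    (X : Matrix κ μ R) (e e' : κ ≃ μ) :
    (X.submatrix id e).det ^ 2 = (X.submatrix id e').det ^ 2 := by
  have h : X.submatrix id e = (X.submatrix id e').submatrix id (e.trans e'.symm) := by
    ext x y
    simp
  rw [h, Matrix.det_permute', mul_pow, ← Int.cast_pow, ← Units.val_pow_eq_pow_val, Int.units_sq]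
  simp

/-- The determinant of a block lower triangular matrix, with blocks indexed by different types in
the source and in the target. -/
theorem Matrix.det_of_sigma_lowerTriangular {R : Type*} [CommRing R] {n : ℕ} {κ μ : Fin n → Type*}
    [∀ a, Fintype (κ a)] [∀ a, DecidableEq (κ a)] (X : Matrix (Σ a, κ a) (Σ a, μ a) R)
    (hX : ∀ a q, a < q → ∀ x y, X ⟨a, x⟩ ⟨q, y⟩ = 0) (ε : ∀ a, κ a ≃ μ a) :
    (X.submatrix id (Equiv.sigmaCongrRight ε)).det =
      ∏ a, (Matrix.of fun x y => X ⟨a, x⟩ ⟨a, ε a y⟩).det := by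
  rw [← Matrix.det_transpose, Matrix.BlockTriangular.det_fintype (b := Sigma.fst)]
  · refine Finset.prod_congr rfl fun a _ => ?_
    rw [← Matrix.det_transpose,
      ← Matrix.det_submatrix_equiv_self (Equiv.sigmaSubtype (β := κ) a).symm]
    rfl
  · rintro ⟨a, x⟩ ⟨q, y⟩ h
    exact hX q a h _ _

theorem Module.Basis.isEmpty_of_eq_bot {k M ι : Type*} [Field k] [AddCommGroup M] [Module k M]
    {p : Submodule k M} (b : Module.Basis ι k p) (hp : p = ⊥) : IsEmpty ι :=
  ⟨fun x => b.ne_zero x (Subtype.ext (Submodule.coe_eq_zero_of_eq_bot hp _))⟩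

section Det

variable {k B : Type*} [Field k] [CommRing B] [Algebra k B]
  (𝓑 : ℕ → Submodule k B) {ι : ℤ → Type*} [∀ n, Fintype (ι n)]
  (b : ∀ n : ℤ, Module.Basis (ι n) k (gr 𝓑 n))

/-- The bijection of index sets induced by an equality of degrees. -/
def degreeCast (ι : ℤ → Type*) {m n : ℤ} (h : m = n) : ι m ≃ ι n :=
  Equiv.cast (congrArg ι h)

omit [∀ n, Fintype (ι n)] in
theorem repr_degreeCast {m n : ℤ} (h : m = n) (v : gr 𝓑 n) (w : gr 𝓑 m) (hvw : (v : B) = w)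
    (x : ι m) : (b n).repr v (degreeCast ι h x) = (b m).repr w x := by
  subst h
  rw [Subtype.ext hvw]
  rfl

variable [∀ n, DecidableEq (ι n)] [GradedAlgebra 𝓑] (ℓ : 𝓑 1)

theorem toMatrix_weightedMap {n : ℕ} (f g : Fin n → ℤ) (c : Fin n → Fin n → k)
    (e : Fin n → Fin n → ℕ) (h : ∀ a b, c a b ≠ 0 → f b + e a b = g a)
    (a q : Fin n) (x : ι (g a)) (y : ι (f q)) :
    LinearMap.toMatrix (Pi.basis fun q => b (f q)) (Pi.basis fun a => b (g a))
      (weightedMap 𝓑 ℓ f g c e h) ⟨a, x⟩ ⟨q, y⟩ =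
      (b (g a)).repr (weightedMap 𝓑 ℓ f g c e h (Pi.single q (b (f q) y)) a) x := by
  rw [LinearMap.toMatrix_apply, Pi.basis_apply, Pi.basis_repr]

theorem toMatrix_weightedMap_eq_zero {n : ℕ} (f g : Fin n → ℤ) (c : Fin n → Fin n → k)
    (e : Fin n → Fin n → ℕ) (h : ∀ a b, c a b ≠ 0 → f b + e a b = g a)
    (a q : Fin n) (hc : c a q = 0) (x : ι (g a)) (y : ι (f q)) :
    LinearMap.toMatrix (Pi.basis fun q => b (f q)) (Pi.basis fun a => b (g a))
      (weightedMap 𝓑 ℓ f g c e h) ⟨a, x⟩ ⟨q, y⟩ = 0 := by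
  rw [toMatrix_weightedMap]
  have h1 : weightedMap 𝓑 ℓ f g c e h (Pi.single q (b (f q) y)) a = 0 := by
    apply Subtype.ext
    rw [weightedMap_single, hc, zero_smul]
    rfl
  rw [h1, map_zero]
  rfl

theorem det_toMatrix_weightedMap {n : ℕ} (f : Fin n → ℤ) (c : Fin n → Fin n → k)
    (e : Fin n → Fin n → ℕ) (h : ∀ a b, c a b ≠ 0 → f b + e a b = f a)
    (hdiag : ∀ a, c a a = 1) (hupper : ∀ a b, b < a → c a b = 0) :
    (LinearMap.toMatrix (Pi.basis fun q => b (f q)) (Pi.basis fun q => b (f q))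
      (weightedMap 𝓑 ℓ f f c e h)).det = 1 := by
  rw [Matrix.BlockTriangular.det_fintype (b := Sigma.fst)]
  · refine Finset.prod_eq_one fun a _ => ?_
    rw [← Matrix.det_submatrix_equiv_self (Equiv.sigmaSubtype (β := fun q => ι (f q)) a).symm]
    have h1 : ((LinearMap.toMatrix (Pi.basis fun q => b (f q)) (Pi.basis fun q => b (f q))
        (weightedMap 𝓑 ℓ f f c e h)).toSquareBlock Sigma.fst a).submatrix
        (Equiv.sigmaSubtype (β := fun q => ι (f q)) a).symm
        (Equiv.sigmaSubtype (β := fun q => ι (f q)) a).symm = 1 := by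
      apply Matrix.ext
      intro x y
      refine (toMatrix_weightedMap 𝓑 b ℓ f f c e h a a x y).trans ?_
      have h2 : weightedMap 𝓑 ℓ f f c e h (Pi.single a (b (f a) y)) a = b (f a) y := by
        have h3 := h a a (by rw [hdiag]; exact one_ne_zero)
        apply Subtype.ext
        rw [weightedMap_single, hdiag, show e a a = 0 by omega, pow_zero, one_mul, one_smul]
      rw [h2, Module.Basis.repr_self, Matrix.one_apply, Finsupp.single_apply]
      simp only [eq_comm]
    rw [h1, Matrix.det_one]
  · rintro ⟨a, x⟩ ⟨q, y⟩ haq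
    exact toMatrix_weightedMap_eq_zero 𝓑 b ℓ f f c e h a q (hupper a q haq) x y

variable (d t i : ℕ)

theorem det_toMatrix_colMap {N : ℕ} {H U : ℕ → ℕ → k} (hU : IsColReduction H U N) :
    (LinearMap.toMatrix (Pi.basis fun q : Fin d => b ((i : ℤ) - (q : ℕ)))
      (Pi.basis fun q : Fin d => b ((i : ℤ) - (q : ℕ))) (colMap 𝓑 ℓ d i U hU.upper)).det = 1 :=
  det_toMatrix_weightedMap 𝓑 b ℓ (fun q : Fin d => (i : ℤ) - (q : ℕ)) _ _ _
    (fun a => hU.diag a) fun a q h => hU.upper a q h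

theorem toMatrix_extMap (a q : Fin d) (x : ι ((i : ℤ) + (t : ℤ) - (pairEquiv d t a : ℕ)))
    (y : ι ((i : ℤ) - (q : ℕ))) :
    LinearMap.toMatrix (extBasis 𝓑 d b (i : ℤ)) (extBasis 𝓑 d b ((i : ℤ) + (t : ℤ)))
        (extMap 𝓑 ℓ d t i) ⟨pairEquiv d t a, x⟩ ⟨q, y⟩ =
      LinearMap.toMatrix (Pi.basis fun q : Fin d => b ((i : ℤ) - (q : ℕ)))
        (Pi.basis fun a : Fin d => b ((i : ℤ) + (t : ℤ) - (pairEquiv d t a : ℕ)))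
        (pairedMap 𝓑 ℓ d t i (fun a b => ((pairedBinom d t a b : ℤ) : k))
          (fun _ _ h => pairedBinom_weight h)) ⟨a, x⟩ ⟨q, y⟩ := by
  rw [LinearMap.toMatrix_apply, LinearMap.toMatrix_apply, extBasis, extBasis,
    Module.Basis.map_apply, extMap_eq_pairedMap, Module.Basis.map_repr, LinearEquiv.trans_apply,
    LinearEquiv.symm_apply_apply, Pi.basis_repr, Pi.basis_repr]
  congr 2
  have h := LinearEquiv.apply_symm_apply (targetEquiv 𝓑 d t i)
    (pairedMap 𝓑 ℓ d t i (fun a b => ((pairedBinom d t a b : ℤ) : k))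
      (fun _ _ h => pairedBinom_weight h)
      (Pi.basis (fun q : Fin d => b ((i : ℤ) - (q : ℕ))) ⟨q, y⟩))
  exact congrFun h a

/-- The column reduction has determinant one, and the order of the target blocks and the
identification of the index sets change only the sign. -/
theorem det_extMap_sq {N : ℕ} {U : ℕ → ℕ → k}
    (hU : IsColReduction (fun a b => ((pairedBinom d t a b : ℤ) : k)) U N)
    (eA : (Σ m : Fin d, ι ((i : ℤ) + (t : ℤ) - (m : ℕ))) ≃ (Σ m : Fin d, ι ((i : ℤ) - (m : ℕ))))
    (E : (Σ a : Fin d, ι ((i : ℤ) + (t : ℤ) - (pairEquiv d t a : ℕ))) ≃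
      (Σ m : Fin d, ι ((i : ℤ) - (m : ℕ)))) :
    ((LinearMap.toMatrix (extBasis 𝓑 d b (i : ℤ)) (extBasis 𝓑 d b ((i : ℤ) + (t : ℤ)))
      (extMap 𝓑 ℓ d t i)).submatrix id eA).det ^ 2 =
    ((LinearMap.toMatrix (Pi.basis fun q : Fin d => b ((i : ℤ) - (q : ℕ)))
      (Pi.basis fun a : Fin d => b ((i : ℤ) + (t : ℤ) - (pairEquiv d t a : ℕ)))
      (pairedMap 𝓑 ℓ d t i (colProd (fun a b => ((pairedBinom d t a b : ℤ) : k)) U)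
        (fun _ _ h => colProd_weight h))).submatrix id E).det ^ 2 := by
  let ρ : (Σ a : Fin d, ι ((i : ℤ) + (t : ℤ) - (pairEquiv d t a : ℕ))) ≃
      (Σ m : Fin d, ι ((i : ℤ) + (t : ℤ) - (m : ℕ))) :=
    Equiv.sigmaCongrLeft (β := fun m : Fin d => ι ((i : ℤ) + (t : ℤ) - (m : ℕ))) (pairEquiv d t)
  rw [← pairedMap_comp_colMap 𝓑 ℓ d t i hU,
    LinearMap.toMatrix_comp _ (Pi.basis fun q : Fin d => b ((i : ℤ) - (q : ℕ))) _,
    Matrix.det_submatrix_sq _ E (ρ.trans eA), ← Matrix.submatrix_mul_equiv _ _ id (ρ.trans eA),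
    Matrix.det_mul, Matrix.det_submatrix_equiv_self, det_toMatrix_colMap 𝓑 b ℓ d i hU,
    mul_one,
    ← Matrix.det_submatrix_equiv_self ρ]
  congr 2
  ext ⟨a, x⟩ y
  rw [Matrix.submatrix_apply, Matrix.submatrix_apply, Matrix.submatrix_apply]
  exact toMatrix_extMap 𝓑 b ℓ d t i a (eA (ρ y)).1 x (eA (ρ y)).2

end Det

/-! ### The determinant as a product over diagonal blocks. -/

theorem mem_qRange {d t i s q : ℕ} :
    q ∈ qRange d t i s ↔ q < d ∧ d ≤ q + t ∧ q + i + t ≤ d - 1 + s ∧ q ≤ i := by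
  rw [qRange, Finset.mem_filter, Finset.mem_range]

/-- Paired blocks are square. The unpaired ones all vanish on the same side, so their size
differences share a sign; as `M` is square these differences sum to zero, and each is zero. -/
theorem card_eq_of_square {k B : Type*} [Field k] [CommRing B] [Algebra k B]
    (𝓑 : ℕ → Submodule k B) {ι : ℤ → Type*} [∀ n, Fintype (ι n)]
    (b : ∀ n : ℤ, Module.Basis (ι n) k (gr 𝓑 n)) {d t i s : ℕ} (hs : IsSocleDegree 𝓑 s)
    (e : ∀ q : qRange d t i s,
      ι ((i : ℤ) - ((q : ℕ) : ℤ) + (qExp d t q : ℤ)) ≃ ι ((i : ℤ) - ((q : ℕ) : ℤ)))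
    (eA : (Σ m : Fin d, ι ((i : ℤ) + (t : ℤ) - (m : ℕ))) ≃ (Σ m : Fin d, ι ((i : ℤ) - (m : ℕ))))
    (a : Fin d) :
    Fintype.card (ι ((i : ℤ) + (t : ℤ) - (pairEquiv d t a : ℕ))) =
      Fintype.card (ι ((i : ℤ) - (a : ℕ))) := by
  have hsum : ∑ a : Fin d, Fintype.card (ι ((i : ℤ) + (t : ℤ) - (pairEquiv d t a : ℕ))) =
      ∑ a : Fin d, Fintype.card (ι ((i : ℤ) - (a : ℕ))) := by
    rw [(pairEquiv d t).sum_comp fun m : Fin d => Fintype.card (ι ((i : ℤ) + (t : ℤ) - (m : ℕ))),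
      ← Fintype.card_sigma, ← Fintype.card_sigma]
    exact Fintype.card_congr eA
  have hpaired : ∀ a : Fin d, IsPaired d t i s a →
      Fintype.card (ι ((i : ℤ) + (t : ℤ) - (pairEquiv d t a : ℕ))) =
      Fintype.card (ι ((i : ℤ) - (a : ℕ))) := by
    intro a ha
    by_cases h : a + t < d
    · rw [coe_pairEquiv, pairRow, if_pos h,
        show (i : ℤ) + (t : ℤ) - ((a + t : ℕ) : ℤ) = (i : ℤ) - (a : ℕ) by omega]
    · have h1 : d ≤ a + t := by omega
      rw [← recMap_target d t i a h1]
      exact Fintype.card_congr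
        (e ⟨a, mem_qRange.2 ⟨a.2, h1, (ha.resolve_left h).1, (ha.resolve_left h).2⟩⟩)
  have hbot : ∀ n, gr 𝓑 n = ⊥ → Fintype.card (ι n) = 0 := by
    intro n hn
    have := (b n).isEmpty_of_eq_bot hn
    exact Fintype.card_eq_zero
  rcases hs.eq_bot_or_eq_bot 𝓑 d t i with h | h
  · refine ((Finset.sum_eq_sum_iff_of_le fun a _ => ?_).1 hsum.symm a (Finset.mem_univ a)).symm
    by_cases ha : IsPaired d t i s a
    · exact (hpaired a ha).ge
    · rw [hbot _ (h a ha)]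
      exact Nat.zero_le _
  · refine (Finset.sum_eq_sum_iff_of_le fun a _ => ?_).1 hsum a (Finset.mem_univ a)
    by_cases ha : IsPaired d t i s a
    · exact (hpaired a ha).le
    · rw [hbot _ (h a ha)]
      exact Nat.zero_le _

theorem prod_fin_eq_prod_qRange {M : Type*} [CommMonoid M] {d t i s : ℕ} (f : Fin d → M)
    (g : qRange d t i s → M)
    (hf : ∀ (a : Fin d) (ha : (a : ℕ) ∈ qRange d t i s), f a = g ⟨a, ha⟩)
    (hf' : ∀ a : Fin d, (a : ℕ) ∉ qRange d t i s → f a = 1) : ∏ a, f a = ∏ q, g q := by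
  have h1 : ∀ a : Fin d, f a = if h : (a : ℕ) ∈ qRange d t i s then g ⟨a, h⟩ else 1 := by
    intro a
    split_ifs with h
    · exact hf a h
    · exact hf' a h
  have hsub : qRange d t i s ⊆ Finset.range d := Finset.filter_subset _ _
  rw [Finset.prod_congr rfl fun a _ => h1 a,
    ← Finset.prod_range fun a => if h : a ∈ qRange d t i s then g ⟨a, h⟩ else 1,
    ← Finset.prod_subset hsub
      fun a _ ha => dif_neg ha, ← Finset.prod_coe_sort]
  exact Finset.prod_congr rfl fun q _ => dif_pos q.2

section DiagBlock

variable {k B : Type*} [Field k] [CommRing B] [Algebra k B]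
  (𝓑 : ℕ → Submodule k B) {ι : ℤ → Type*} [∀ n, Fintype (ι n)] [∀ n, DecidableEq (ι n)]
  (b : ∀ n : ℤ, Module.Basis (ι n) k (gr 𝓑 n)) [GradedAlgebra 𝓑] (ℓ : 𝓑 1) {d t i : ℕ}
  (c : ℕ → ℕ → k) (hc : ∀ a q, c a q ≠ 0 → pairRow d t a ≤ t + q)

theorem toMatrix_pairedMap_diag (a : Fin d) {m : ℤ}
    (hm : m = (i : ℤ) + (t : ℤ) - (pairEquiv d t a : ℕ)) (x : ι m) (y : ι ((i : ℤ) - (a : ℕ)))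
    (w : gr 𝓑 m) (hw : (w : B) = (ℓ : B) ^ (t + a - pairRow d t a) * b _ y) :
    LinearMap.toMatrix (Pi.basis fun q : Fin d => b ((i : ℤ) - (q : ℕ)))
        (Pi.basis fun a : Fin d => b ((i : ℤ) + (t : ℤ) - (pairEquiv d t a : ℕ)))
        (pairedMap 𝓑 ℓ d t i c hc) ⟨a, degreeCast ι hm x⟩ ⟨a, y⟩ =
      c a a * (b m).repr w x := by
  rw [← smul_eq_mul, ← Finsupp.smul_apply, ← map_smul]
  refine (toMatrix_weightedMap 𝓑 b ℓ (fun q : Fin d => (i : ℤ) - (q : ℕ))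
    (fun a : Fin d => (i : ℤ) + (t : ℤ) - (pairEquiv d t a : ℕ)) _ _ _ a a _ y).trans ?_
  refine repr_degreeCast 𝓑 b hm _ _ ?_ x
  refine (pairedMap_single 𝓑 ℓ i c hc a (b _ y) a).trans ?_
  rw [Submodule.coe_smul, hw]

theorem det_diagBlock_sq_of_le (a : Fin d) (ha : d ≤ a + t)
    (ε : ι ((i : ℤ) + (t : ℤ) - (pairEquiv d t a : ℕ)) ≃ ι ((i : ℤ) - (a : ℕ)))
    (e : ι ((i : ℤ) - ((a : ℕ) : ℤ) + (qExp d t a : ℤ)) ≃ ι ((i : ℤ) - ((a : ℕ) : ℤ))) :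
    (Matrix.of fun x y => LinearMap.toMatrix (Pi.basis fun q : Fin d => b ((i : ℤ) - (q : ℕ)))
        (Pi.basis fun a : Fin d => b ((i : ℤ) + (t : ℤ) - (pairEquiv d t a : ℕ)))
        (pairedMap 𝓑 ℓ d t i c hc) ⟨a, x⟩ ⟨a, ε y⟩).det ^ 2 =
      (c a a ^ 2) ^ hdim 𝓑 ((i : ℤ) - (a : ℕ)) *
      ((LinearMap.toMatrix (b ((i : ℤ) - ((a : ℕ) : ℤ)))
        (b ((i : ℤ) - ((a : ℕ) : ℤ) + (qExp d t a : ℤ))) (recMap 𝓑 ℓ d t i a)).submatrix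
          id e).det ^ 2 := by
  set γ := degreeCast ι (recMap_target d t i a ha) with hγ
  have h : (Matrix.of fun x y => LinearMap.toMatrix
      (Pi.basis fun q : Fin d => b ((i : ℤ) - (q : ℕ)))
      (Pi.basis fun a : Fin d => b ((i : ℤ) + (t : ℤ) - (pairEquiv d t a : ℕ)))
      (pairedMap 𝓑 ℓ d t i c hc) ⟨a, x⟩ ⟨a, ε y⟩).submatrix γ γ =
      c a a • (LinearMap.toMatrix (b ((i : ℤ) - ((a : ℕ) : ℤ)))
        (b ((i : ℤ) - ((a : ℕ) : ℤ) + (qExp d t a : ℤ))) (recMap 𝓑 ℓ d t i a)).submatrix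
          id (γ.trans ε) := by
    ext x y
    rw [Matrix.smul_apply, Matrix.submatrix_apply, Matrix.submatrix_apply, Matrix.of_apply,
      smul_eq_mul]
    refine (toMatrix_pairedMap_diag 𝓑 b ℓ c hc a (recMap_target d t i a ha) x (ε (γ y))
      (recMap 𝓑 ℓ d t i a (b _ (ε (γ y)))) (by rw [coe_recMap, qExp_eq a.2 ha])).trans ?_
    rw [LinearMap.toMatrix_apply]
    rfl
  rw [← Matrix.det_submatrix_equiv_self γ, h, Matrix.det_smul, mul_pow,
    Matrix.det_submatrix_sq _ (γ.trans ε) e, Fintype.card_congr e, hdim,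
    Module.finrank_eq_card_basis (b ((i : ℤ) - ((a : ℕ) : ℤ))), ← pow_mul, ← pow_mul, mul_comm 2]

theorem det_diagBlock_sq_of_lt (a : Fin d) (ha : a + t < d) (hca : c a a = 1)
    (ε : ι ((i : ℤ) + (t : ℤ) - (pairEquiv d t a : ℕ)) ≃ ι ((i : ℤ) - (a : ℕ))) :
    (Matrix.of fun x y => LinearMap.toMatrix (Pi.basis fun q : Fin d => b ((i : ℤ) - (q : ℕ)))
        (Pi.basis fun a : Fin d => b ((i : ℤ) + (t : ℤ) - (pairEquiv d t a : ℕ)))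
        (pairedMap 𝓑 ℓ d t i c hc) ⟨a, x⟩ ⟨a, ε y⟩).det ^ 2 = 1 := by
  have h0 : pairRow d t a = a + t := if_pos ha
  have hm : (i : ℤ) - (a : ℕ) = (i : ℤ) + (t : ℤ) - (pairEquiv d t a : ℕ) := by
    rw [coe_pairEquiv, h0]
    omega
  set γ := degreeCast ι hm with hγ
  have h : (Matrix.of fun x y => LinearMap.toMatrix
      (Pi.basis fun q : Fin d => b ((i : ℤ) - (q : ℕ)))
      (Pi.basis fun a : Fin d => b ((i : ℤ) + (t : ℤ) - (pairEquiv d t a : ℕ)))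
      (pairedMap 𝓑 ℓ d t i c hc) ⟨a, x⟩ ⟨a, ε y⟩).submatrix γ γ =
      (1 : Matrix (ι ((i : ℤ) - (a : ℕ))) _ k).submatrix id (γ.trans ε) := by
    ext x y
    rw [Matrix.submatrix_apply, Matrix.submatrix_apply, Matrix.of_apply]
    refine (toMatrix_pairedMap_diag 𝓑 b ℓ c hc a hm x _ (b _ (ε (γ y))) ?_).trans ?_
    · rw [h0, show t + (a : ℕ) - (a + t) = 0 by omega, pow_zero, one_mul]
    · rw [hca, one_mul, Module.Basis.repr_self, Finsupp.single_apply, Matrix.one_apply]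
      exact if_congr eq_comm rfl rfl
  rw [← Matrix.det_submatrix_equiv_self γ, h, Matrix.det_submatrix_sq _ _ (Equiv.refl _)]
  simp

theorem det_extMap_sq_eq_prod {s : ℕ} (hs : IsSocleDegree 𝓑 s) {N : ℕ} {U : ℕ → ℕ → k}
    (hU : IsColReduction (fun a b => ((pairedBinom d t a b : ℤ) : k)) U N)
    (hN : ∀ q : Fin d, IsPaired d t i s q → (q : ℕ) ≤ N)
    (e : ∀ q : qRange d t i s,
      ι ((i : ℤ) - ((q : ℕ) : ℤ) + (qExp d t q : ℤ)) ≃ ι ((i : ℤ) - ((q : ℕ) : ℤ)))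
    (eA : (Σ m : Fin d, ι ((i : ℤ) + (t : ℤ) - (m : ℕ))) ≃
      (Σ m : Fin d, ι ((i : ℤ) - (m : ℕ)))) :
    ((LinearMap.toMatrix (extBasis 𝓑 d b (i : ℤ)) (extBasis 𝓑 d b ((i : ℤ) + (t : ℤ)))
      (extMap 𝓑 ℓ d t i)).submatrix id eA).det ^ 2 =
    ∏ q : qRange d t i s,
      ((colProd (fun a b => ((pairedBinom d t a b : ℤ) : k)) U q q ^ 2) ^
          hdim 𝓑 ((i : ℤ) - ((q : ℕ) : ℤ)) *
        ((LinearMap.toMatrix (b ((i : ℤ) - ((q : ℕ) : ℤ)))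
          (b ((i : ℤ) - ((q : ℕ) : ℤ) + (qExp d t q : ℤ))) (recMap 𝓑 ℓ d t i q)).submatrix
            id (e q)).det ^ 2) := by
  have hcard := card_eq_of_square 𝓑 b hs e eA
  -- Any bijections will do, since the determinant is squared.
  have ε := fun a : Fin d => Fintype.equivOfCardEq (hcard a)
  rw [det_extMap_sq 𝓑 b ℓ d t i hU eA (Equiv.sigmaCongrRight ε),
    Matrix.det_of_sigma_lowerTriangular, ← Finset.prod_pow]
  · apply prod_fin_eq_prod_qRange
    · intro a ha
      exact det_diagBlock_sq_of_le 𝓑 b ℓ _ _ a (mem_qRange.1 ha).2.1 (ε a) (e ⟨a, ha⟩)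
    · intro a ha
      by_cases hat : a + t < d
      · apply det_diagBlock_sq_of_lt 𝓑 b ℓ _ _ a hat
        have h1 := hU.leadMinor_succ a (hN a (Or.inl hat))
        rw [leadMinor_intCast, leadMinor_intCast, leadMinor_pairedBinom_of_le d t _ (by omega),
          leadMinor_pairedBinom_of_le d t _ (by omega), Int.cast_one, one_mul] at h1
        exact h1.symm
      · have hnp : ¬ IsPaired d t i s a := by
          rw [mem_qRange] at ha
          unfold IsPaired
          omega
        have hempty : IsEmpty (ι ((i : ℤ) + (t : ℤ) - (pairEquiv d t a : ℕ))) := by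
          rcases hs.eq_bot_or_eq_bot 𝓑 d t i with h | h
          · have := (b _).isEmpty_of_eq_bot (h a hnp)
            exact (ε a).isEmpty
          · exact (b _).isEmpty_of_eq_bot (h a hnp)
        rw [Matrix.det_isEmpty, one_pow]
  · intro a q haq x y
    by_cases hq : IsPaired d t i s q
    · exact toMatrix_weightedMap_eq_zero 𝓑 b ℓ (fun q : Fin d => (i : ℤ) - (q : ℕ))
        (fun a : Fin d => (i : ℤ) + (t : ℤ) - (pairEquiv d t a : ℕ)) _ _ _ a q
        (hU.lower a q haq (by have := hN q hq; have : (a : ℕ) < q := haq; omega)) x y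
    · exfalso
      rcases hs.eq_bot_or_eq_bot 𝓑 d t i with h | h
      · exact ((b _).isEmpty_of_eq_bot (h q hq)).elim y
      · exact ((b _).isEmpty_of_eq_bot (h q hq)).elim ((ε q).symm y)

end DiagBlock

/-! ### Telescoping the pivots into `F₂` and `F₃`. -/

section Factors

/-- Summation by parts for `c r = D (r + 1) / D r`. The last value `D n` may be zero, so it is kept
apart with a natural exponent. -/
theorem prod_pivots_pow {k : Type*} [Field k] (D c : ℕ → k) (h : ℕ → ℕ) (m n : ℕ) (hmn : m < n)
    (hm : D m = 1) (hD : ∀ r, m ≤ r → r < n → D r ≠ 0)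
    (hc : ∀ r, m ≤ r → r < n → D (r + 1) = D r * c r) :
    ∏ q ∈ Finset.Ico m n, c q ^ h q =
      (∏ r ∈ Finset.Ico (m + 1) n, D r ^ ((h (r - 1) : ℤ) - h r)) * D n ^ h (n - 1) := by
  induction n, hmn using Nat.le_induction with
  | base =>
    rw [Nat.Ico_succ_singleton, Finset.prod_singleton, Finset.Ico_self, Finset.prod_empty, one_mul,
      hc m le_rfl (Nat.lt_succ_self m), hm, one_mul, Nat.succ_sub_one]
  | succ n hn ih =>
    have hn' : m < n := hn
    rw [Finset.prod_Ico_succ_top hn'.le, ih (fun r h1 h2 => hD r h1 (by omega))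
      (fun r h1 h2 => hc r h1 (by omega)), Finset.prod_Ico_succ_top hn, hc n hn'.le (by omega),
      Nat.add_sub_cancel, mul_pow, zpow_sub₀ (hD n hn'.le (by omega)), zpow_natCast, zpow_natCast]
    have := pow_ne_zero (h n) (hD n hn'.le (by omega))
    field_simp

variable {k B : Type*} [Field k] [CommRing B] [Algebra k B] (𝓑 : ℕ → Submodule k B)

theorem absDetC_sq (t p d : ℕ) :
    absDetC k t p d ^ 2 = ((((matC t p d).det : ℤ) : k)) ^ 2 := by
  rw [absDetC, ← Int.cast_pow, sq_abs, Int.cast_pow]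

theorem factorTwo_sq (d t i s : ℕ) :
    factorTwo 𝓑 d t i s ^ 2 =
      ∏ r ∈ Finset.Ico (d - t + 1) (min d (min (i + 2) (d + s - (i + t)))),
        ((((matC t (d - r) d).det : ℤ) : k) ^ 2) ^
          ((hdim 𝓑 ((i : ℤ) - ((r - 1 : ℕ) : ℤ)) : ℤ) - hdim 𝓑 ((i : ℤ) - (r : ℕ))) := by
  rw [factorTwo, ← Finset.prod_pow]
  refine Finset.prod_bij' (fun p _ => d - p) (fun r _ => d - r) ?_ ?_ ?_ ?_ ?_
  · intro p hp
    rw [Finset.mem_Icc] at hp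
    rw [Finset.mem_Ico]
    omega
  · intro r hr
    rw [Finset.mem_Ico] at hr
    rw [Finset.mem_Icc]
    omega
  · intro p hp
    rw [Finset.mem_Icc] at hp
    omega
  · intro r hr
    rw [Finset.mem_Ico] at hr
    omega
  · intro p hp
    rw [Finset.mem_Icc] at hp
    rw [← zpow_natCast, zpow_comm, zpow_natCast, absDetC_sq, show d - (d - p) = p by omega,
      show (i : ℤ) + p - (d - 1) = (i : ℤ) - ((d - p - 1 : ℕ) : ℤ) by omega,
      show (i : ℤ) + p - d = (i : ℤ) - ((d - p : ℕ) : ℤ) by omega]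

theorem qRange_eq_Ico (d t i s : ℕ) (hd : 1 ≤ d) :
    qRange d t i s = Finset.Ico (d - t) (min d (min (i + 1) (d + s - (i + t)))) := by
  ext q
  rw [mem_qRange, Finset.mem_Ico]
  omega

theorem prod_qRange_pivots (d t i s : ℕ) (hd : 1 ≤ d) (c : ℕ → k)
    (hne : ∀ q ∈ qRange d t i s, (((matC t (d - q) d).det : ℤ) : k) ^ 2 ≠ 0)
    (hc : ∀ q ∈ qRange d t i s, (((matC t (d - (q + 1)) d).det : ℤ) : k) ^ 2 =
      (((matC t (d - q) d).det : ℤ) : k) ^ 2 * c q) :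
    ∏ q ∈ qRange d t i s, c q ^ hdim 𝓑 ((i : ℤ) - (q : ℕ)) =
      factorTwo 𝓑 d t i s ^ 2 * factorThree 𝓑 d t i s ^ 2 := by
  set n := min d (min (i + 1) (d + s - (i + t))) with hn
  rw [factorTwo_sq]
  rw [qRange_eq_Ico d t i s hd] at hne hc ⊢
  by_cases hmn : d - t < n
  · have hm : (((matC t (d - (d - t)) d).det : ℤ) : k) ^ 2 = 1 := by
      rw [← Int.cast_pow, ← leadMinor_pairedBinom_sq d t (d - t) le_rfl (by omega),
        leadMinor_pairedBinom_of_le d t _ le_rfl]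
      simp
    rw [prod_pivots_pow (fun r => (((matC t (d - r) d).det : ℤ) : k) ^ 2) c
      (fun q => hdim 𝓑 ((i : ℤ) - (q : ℕ))) (d - t) n hmn hm
      (fun r h1 h2 => hne r (Finset.mem_Ico.2 ⟨h1, h2⟩))
      (fun r h1 h2 => hc r (Finset.mem_Ico.2 ⟨h1, h2⟩))]
    -- The boundary factor at `n` depends on which bound attains the minimum: `d + s - i - t` gives
    -- `F₃`, `d` gives a determinant `±1`, and `i + 1` gives the top factor of `F₂`, whose second
    -- dimension is that of `B` in degree `-1`.
    by_cases hA : n + (i + t) = d + s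
    · have h3 : factorThree 𝓑 d t i s ^ 2 = ((((matC t (d - n) d).det : ℤ) : k) ^ 2) ^
          hdim 𝓑 ((i : ℤ) - ((n - 1 : ℕ) : ℤ)) := by
        rw [factorThree, if_pos ⟨by omega, by omega⟩, ← pow_mul, mul_comm, pow_mul, absDetC_sq,
          show i + t - s = d - n by omega,
          show 2 * (i : ℤ) - (d - 1) + t - s = (i : ℤ) - ((n - 1 : ℕ) : ℤ) by omega]
      rw [h3, show min d (min (i + 2) (d + s - (i + t))) = n by omega]
    · have h3 : factorThree 𝓑 d t i s = 1 := by
        rw [factorThree, if_neg (by omega)]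
      rw [h3, one_pow, mul_one]
      by_cases hnd : n = d
      · rw [show min d (min (i + 2) (d + s - (i + t))) = n by omega]
        rw [hnd, Nat.sub_self, ← Int.cast_pow, det_matC_zero_sq]
        simp
      · rw [show min d (min (i + 2) (d + s - (i + t))) = n + 1 by omega,
          Finset.prod_Ico_succ_top (by omega)]
        have h0 : hdim 𝓑 ((i : ℤ) - (n : ℕ)) = 0 := by
          rw [hdim, gr_eq_bot_of_neg 𝓑 (by omega), finrank_bot]
        rw [h0, Nat.cast_zero, sub_zero, zpow_natCast]
  · have h3 : factorThree 𝓑 d t i s = 1 := by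
      rw [factorThree, if_neg (by omega)]
    rw [h3, Finset.Ico_eq_empty (by omega), Finset.Ico_eq_empty (by omega)]
    simp

end Factors

/-! ### The theorem. -/

/-- The square of a pivot is a quotient of squares of determinants of the matrices
`C_{t,p,d}`. -/
theorem det_matC_succ_sq {k : Type*} [Field k] {d t N q : ℕ} {U : ℕ → ℕ → k}
    (hU : IsColReduction (fun a b => ((pairedBinom d t a b : ℤ) : k)) U N) (hqN : q ≤ N)
    (hq : d - t ≤ q) (hqd : q < d) :
    (((matC t (d - (q + 1)) d).det : ℤ) : k) ^ 2 = (((matC t (d - q) d).det : ℤ) : k) ^ 2 *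
      colProd (fun a b => ((pairedBinom d t a b : ℤ) : k)) U q q ^ 2 := by
  have h := hU.leadMinor_succ q hqN
  rw [leadMinor_intCast, leadMinor_intCast] at h
  rw [← Int.cast_pow, ← Int.cast_pow, ← leadMinor_pairedBinom_sq d t (q + 1) (by omega) hqd,
    ← leadMinor_pairedBinom_sq d t q hq hqd.le, Int.cast_pow, Int.cast_pow, h, mul_pow]

theorem theorem3p6 {k B : Type*} [Field k] [CommRing B] [Algebra k B]
    (𝓑 : ℕ → Submodule k B) [GradedAlgebra 𝓑] (hB : IsStandardGradedArtinian 𝓑)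
    (s : ℕ) (hs : IsSocleDegree 𝓑 s)
    (d : ℕ) (hd : 1 ≤ d) (i t : ℕ)
    (hchar : CharCond k t d (max 1 (max (d - i) (i + t + 1 - s))))
    (ℓ : 𝓑 1) :
    -- the full rank criterion; the maps are those with `max(0, d - t) ≤ q ≤ d - 1`
    (CharCond k t d (max 1 (max (d - 1 - i) (i + t - s))) →
      (HasFullRank (extMap 𝓑 ℓ d t i) ↔
        FullRankForSameReason (fun q : Finset.Icc (d - t) (d - 1) => recMap 𝓑 ℓ d t i q))) ∧
    -- one direction needs no further condition on the characteristic
    (HasFullRank (extMap 𝓑 ℓ d t i) →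
      FullRankForSameReason (fun q : Finset.Icc (d - t) (d - 1) => recMap 𝓑 ℓ d t i q)) ∧
    -- the determinant formula, up to sign, for arbitrary bases `b` of the pieces of `B`;
    -- bijections `e q` and `eA` of the index sets exist exactly if the matrices are square
    (∀ (ι : ℤ → Type*) [∀ n, Fintype (ι n)] [∀ n, DecidableEq (ι n)]
      (b : ∀ n : ℤ, Module.Basis (ι n) k (gr 𝓑 n))
      (e : ∀ q : qRange d t i s,
        ι ((i : ℤ) - ((q : ℕ) : ℤ) + (qExp d t q : ℤ)) ≃ ι ((i : ℤ) - ((q : ℕ) : ℤ)))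
      (eA : (Σ m : Fin d, ι ((i : ℤ) + (t : ℤ) - (m : ℕ))) ≃
        (Σ m : Fin d, ι ((i : ℤ) - (m : ℕ)))),
      let detM : k := ((LinearMap.toMatrix (extBasis 𝓑 d b (i : ℤ))
        (extBasis 𝓑 d b ((i : ℤ) + (t : ℤ))) (extMap 𝓑 ℓ d t i)).submatrix id eA).det
      let F₁ : k := ∏ q : qRange d t i s,
        ((LinearMap.toMatrix (b ((i : ℤ) - ((q : ℕ) : ℤ)))
          (b ((i : ℤ) - ((q : ℕ) : ℤ) + (qExp d t q : ℤ)))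
          (recMap 𝓑 ℓ d t i q)).submatrix id (e q)).det
      let F : k := F₁ * factorTwo 𝓑 d t i s * factorThree 𝓑 d t i s
      detM = F ∨ detM = -F) := by
  refine ⟨fun hchar' => ⟨fullRankForSameReason_of_hasFullRank 𝓑 ℓ hB hs hd hchar,
    hasFullRank_of_fullRankForSameReason 𝓑 ℓ hB hs hd hchar hchar'⟩,
    fullRankForSameReason_of_hasFullRank 𝓑 ℓ hB hs hd hchar, ?_⟩
  intro ι _ _ b e eA
  simp only []
  obtain ⟨N, U, hU, hE, hN⟩ := exists_isEchelon hchar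
  have hN' : ∀ q : Fin d, IsPaired d t i s q → (q : ℕ) ≤ N := by
    intro q hq
    have := hN q hq
    omega
  have hqN : ∀ q ∈ qRange d t i s, q ≤ N := by
    intro q hq
    rw [mem_qRange] at hq
    exact hN' ⟨q, hq.1⟩ (Or.inr hq.2.2)
  -- Only the pivots before `q` enter here, and they are nonzero even if the last one is not.
  have hne : ∀ q ∈ qRange d t i s, (((matC t (d - q) d).det : ℤ) : k) ^ 2 ≠ 0 := by
    intro q hq
    have h1 := mem_qRange.1 hq
    have h2 : leadMinor (fun a b => ((pairedBinom d t a b : ℤ) : k)) q ≠ 0 := by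
      rw [hU.leadMinor_eq_prod q (by have := hqN q hq; omega)]
      refine Finset.prod_ne_zero_iff.2 fun a ha => hE.diag a ?_
      exact (Finset.mem_range.1 ha).trans_le (hqN q hq)
    rw [leadMinor_intCast] at h2
    rw [← Int.cast_pow, ← leadMinor_pairedBinom_sq d t q (by omega) h1.1.le, Int.cast_pow]
    exact pow_ne_zero 2 h2
  rw [← sq_eq_sq_iff_eq_or_eq_neg, det_extMap_sq_eq_prod 𝓑 b ℓ hs hU hN' e eA,
    Finset.prod_mul_distrib, mul_pow, mul_pow, ← Finset.prod_pow, mul_comm, mul_assoc,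
    ← prod_qRange_pivots 𝓑 d t i s hd
      (fun q => colProd (fun a b => ((pairedBinom d t a b : ℤ) : k)) U q q ^ 2) hne
      (fun q hq => det_matC_succ_sq hU (hqN q hq) (by have := mem_qRange.1 hq; omega)
        (mem_qRange.1 hq).1),
    ← Finset.prod_coe_sort (qRange d t i s)]
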